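/- **Setting.** Let $L$ be a finite-dimensional complex simple Lie algebra of type $G_2$ with Cartan subalgebra $H$, root system $\Phi$ and fundamental roots $a$ (short) and $b$ (long), so that the positive roots are $a,\ b,\ a+b,\ 2a+b,\ 3a+b,\ 3a+2b$. Let $\{e_r\ (r\in\Phi),\ h_a, h_b\}$ be a Chevalley basis of $L$: $e_r$ is a root vector for $r$, $[e_r,e_{-r}]=h_r$ is the coroot of $r$, and $[e_r,e_s]=N_{r,s}e_{r+s}$ with $N_{r,s}=\pm(p+1)$ whenever $r,s,r+s\in\Phi$, where $p$ is the greatest integer for which $s-pr$ is a root; put $N_{r,s}=0$ otherwise. Write $$N_{a,b}=\epsilon_1,\quad N_{a,a+b}=2\epsilon_2,\quad N_{a,2a+b}=3\epsilon_3,\quad N_{b,3a+b}=\epsilon_4,\quad \epsilon_5=\frac{\epsilon_1\epsilon_3}{\epsilon_4}.$$ Let $K$ be a commutative ring with identity, $L_{\mathbb Z}$ the $\mathbb Z$-span of the Chevalley basis and $L_K=K\otimes L_{\mathbb Z}$. For $r\in\Phi$ and $t\in K$ let $x_r(t)=\sum_{n\ge 0}t^n\,\frac{(\mathrm{ad}\,e_r)^n}{n!}$,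 acting on $L_K$; these operators generate the Chevalley group over $K$. Let $[g,h]=g^{-1}h^{-1}gh$, and let $$M_{r,s,i}=\frac1{i!}N_{r,s}N_{r,r+s}\cdots N_{r,(i-1)r+s},$$ $$C_{i1,rs}=M_{r,s,i},\quad C_{1j,rs}=(-1)^jM_{s,r,j},\quad C_{32,rs}=\tfrac13M_{r+s,r,2},\quad C_{23,rs}=-\tfrac23M_{s+r,s,2}.$$ **Claim.** (A) For all $r,s\in\Phi$ with $r+s\in\Phi$, every pair of positive integers $(i,j)$ with $ir+js\in\Phi$ is one of $(1,1),(2,1),(1,2),(3,1),(1,3),(3,2),(2,3)$, the corresponding $C_{ij,rs}$ are integers, and for all $t,u\in K$ $$[x_s(u),x_r(t)]=\prod_{i,j>0,\ ir+js\in\Phi}x_{ir+js}\bigl(C_{ij,rs}(-t)^iu^j\bigr),$$ the factors being taken in the order of that list (increasing $i+j$). (B) For each of the 60 ordered pairs $(s,r)$ below (these are all pairs of roots whose sum is a root) every $C_{ij,rs}$ with $ir+js\in\Phi$ is the signed monomial in $\epsilon_1,\dots,\epsilon_5$ for which the factor $x_{ir+js}(C_{ij,rs}(-t)^iu^j)$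 of (A) is the one displayed; and for all $t,u\in K$ the following formulas hold. 1. $[x_{b}(u),x_{a}(t)]=x_{a+b}(-\epsilon_1tu)\,x_{2a+b}(\epsilon_1\epsilon_2t^2u)\,x_{3a+b}(-\epsilon_1\epsilon_2\epsilon_3t^3u)\,x_{3a+2b}(-\epsilon_2\epsilon_5t^3u^2)$ 2. $[x_{a}(u),x_{b}(t)]=x_{a+b}(\epsilon_1tu)\,x_{2a+b}(-\epsilon_1\epsilon_2tu^2)\,x_{3a+b}(\epsilon_1\epsilon_2\epsilon_3tu^3)\,x_{3a+2b}(-2\epsilon_2\epsilon_5t^2u^3)$ 3. $[x_{a+b}(u),x_{a}(t)]=x_{2a+b}(-2\epsilon_2tu)\,x_{3a+b}(3\epsilon_2\epsilon_3t^2u)\,x_{3a+2b}(-3\epsilon_2\epsilon_5tu^2)$ 4. $[x_{2a+b}(u),x_{a}(t)]=x_{3a+b}(-3\epsilon_3tu)$ 5. $[x_{3a+b}(u),x_{b}(t)]=x_{3a+2b}(-\epsilon_4tu)$ 6. $[x_{2a+b}(u),x_{a+b}(t)]=x_{3a+2b}(3\epsilon_5tu)$ 7. $[x_{-b}(u),x_{-a}(t)]=x_{-a-b}(\epsilon_1tu)\,x_{-2a-b}(\epsilon_1\epsilon_2t^2u)\,x_{-3a-b}(\epsilon_1\epsilon_2\epsilon_3t^3u)\,x_{-3a-2b}(-\epsilon_2\epsilon_5t^3u^2)$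 8. $[x_{-a}(u),x_{-b}(t)]=x_{-a-b}(-\epsilon_1tu)\,x_{-2a-b}(-\epsilon_1\epsilon_2tu^2)\,x_{-3a-b}(-\epsilon_1\epsilon_2\epsilon_3tu^3)\,x_{-3a-2b}(-2\epsilon_2\epsilon_5t^2u^3)$ 9. $[x_{-a-b}(u),x_{-a}(t)]=x_{-2a-b}(2\epsilon_2tu)\,x_{-3a-b}(3\epsilon_2\epsilon_3t^2u)\,x_{-3a-2b}(-3\epsilon_2\epsilon_5tu^2)$ 10. $[x_{-2a-b}(u),x_{-a}(t)]=x_{-3a-b}(3\epsilon_3tu)$ 11. $[x_{-3a-b}(u),x_{-b}(t)]=x_{-3a-2b}(\epsilon_4tu)$ 12. $[x_{-2a-b}(u),x_{-a-b}(t)]=x_{-3a-2b}(-3\epsilon_5tu)$ 13. $[x_{-a-b}(u),x_{a}(t)]=x_{-b}(3\epsilon_1tu)$ 14. $[x_{-2a-b}(u),x_{a}(t)]=x_{-a-b}(2\epsilon_2tu)\,x_{-b}(3\epsilon_1\epsilon_2t^2u)\,x_{-3a-2b}(3\epsilon_2\epsilon_5tu^2)$ 15. $[x_{-3a-b}(u),x_{a}(t)]=x_{-2a-b}(\epsilon_3tu)\,x_{-a-b}(\epsilon_2\epsilon_3t^2u)\,x_{-b}(\epsilon_1\epsilon_2\epsilon_3t^3u)\,x_{-3a-2b}(\epsilon_2\epsilon_5t^3u^2)$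 16. $[x_{a}(u),x_{-3a-b}(t)]=x_{-2a-b}(-\epsilon_3tu)\,x_{-a-b}(-\epsilon_2\epsilon_3tu^2)\,x_{-b}(-\epsilon_1\epsilon_2\epsilon_3tu^3)\,x_{-3a-2b}(2\epsilon_2\epsilon_5t^2u^3)$ 17. $[x_{b}(u),x_{-a-b}(t)]=x_{-a}(\epsilon_1tu)\,x_{-2a-b}(-\epsilon_1\epsilon_2t^2u)\,x_{-3a-2b}(\epsilon_1\epsilon_2\epsilon_5t^3u)\,x_{-3a-b}(-\epsilon_2\epsilon_3t^3u^2)$ 18. $[x_{-a-b}(u),x_{b}(t)]=x_{-a}(-\epsilon_1tu)\,x_{-2a-b}(\epsilon_1\epsilon_2tu^2)\,x_{-3a-2b}(-\epsilon_1\epsilon_2\epsilon_5tu^3)\,x_{-3a-b}(-2\epsilon_2\epsilon_3t^2u^3)$ 19. $[x_{-3a-2b}(u),x_{b}(t)]=x_{-3a-b}(\epsilon_4tu)$ 20. $[x_{-a}(u),x_{a+b}(t)]=x_{b}(3\epsilon_1tu)$ 21. $[x_{-b}(u),x_{a+b}(t)]=x_{a}(-\epsilon_1tu)\,x_{2a+b}(-\epsilon_1\epsilon_2t^2u)\,x_{3a+2b}(-\epsilon_1\epsilon_2\epsilon_5t^3u)\,x_{3a+b}(-\epsilon_2\epsilon_3t^3u^2)$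 22. $[x_{a+b}(u),x_{-b}(t)]=x_{a}(\epsilon_1tu)\,x_{2a+b}(\epsilon_1\epsilon_2tu^2)\,x_{3a+2b}(\epsilon_1\epsilon_2\epsilon_5tu^3)\,x_{3a+b}(-2\epsilon_2\epsilon_3t^2u^3)$ 23. $[x_{-2a-b}(u),x_{a+b}(t)]=x_{-a}(-2\epsilon_2tu)\,x_{b}(-3\epsilon_1\epsilon_2t^2u)\,x_{-3a-b}(3\epsilon_2\epsilon_3tu^2)$ 24. $[x_{-3a-2b}(u),x_{a+b}(t)]=x_{-2a-b}(-\epsilon_5tu)\,x_{-a}(\epsilon_2\epsilon_5t^2u)\,x_{b}(\epsilon_1\epsilon_2\epsilon_5t^3u)\,x_{-3a-b}(\epsilon_2\epsilon_3t^3u^2)$ 25. $[x_{a+b}(u),x_{-3a-2b}(t)]=x_{-2a-b}(\epsilon_5tu)\,x_{-a}(-\epsilon_2\epsilon_5tu^2)\,x_{b}(-\epsilon_1\epsilon_2\epsilon_5tu^3)\,x_{-3a-b}(2\epsilon_2\epsilon_3t^2u^3)$ 26. $[x_{-a}(u),x_{2a+b}(t)]=x_{a+b}(2\epsilon_2tu)\,x_{3a+2b}(-3\epsilon_2\epsilon_5t^2u)\,x_{b}(-3\epsilon_1\epsilon_2tu^2)$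 27. $[x_{-a-b}(u),x_{2a+b}(t)]=x_{a}(-2\epsilon_2tu)\,x_{3a+b}(-3\epsilon_2\epsilon_3t^2u)\,x_{-b}(3\epsilon_1\epsilon_2tu^2)$ 28. $[x_{-3a-b}(u),x_{2a+b}(t)]=x_{-a}(-\epsilon_3tu)\,x_{a+b}(-\epsilon_2\epsilon_3t^2u)\,x_{3a+2b}(\epsilon_2\epsilon_3\epsilon_5t^3u)\,x_{b}(-\epsilon_1\epsilon_2t^3u^2)$ 29. $[x_{2a+b}(u),x_{-3a-b}(t)]=x_{-a}(\epsilon_3tu)\,x_{a+b}(\epsilon_2\epsilon_3tu^2)\,x_{3a+2b}(-\epsilon_2\epsilon_3\epsilon_5tu^3)\,x_{b}(-2\epsilon_1\epsilon_2t^2u^3)$ 30. $[x_{-3a-2b}(u),x_{2a+b}(t)]=x_{-a-b}(\epsilon_5tu)\,x_{a}(-\epsilon_2\epsilon_5t^2u)\,x_{3a+b}(-\epsilon_2\epsilon_3\epsilon_5t^3u)\,x_{-b}(\epsilon_1\epsilon_2t^3u^2)$ 31. $[x_{2a+b}(u),x_{-3a-2b}(t)]=x_{-a-b}(-\epsilon_5tu)\,x_{a}(\epsilon_2\epsilon_5tu^2)\,x_{3a+b}(\epsilon_2\epsilon_3\epsilon_5tu^3)\,x_{-b}(2\epsilon_1\epsilon_2t^2u^3)$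 32. $[x_{-a}(u),x_{3a+b}(t)]=x_{2a+b}(\epsilon_3tu)\,x_{a+b}(-\epsilon_2\epsilon_3tu^2)\,x_{b}(\epsilon_1\epsilon_2\epsilon_3tu^3)\,x_{3a+2b}(2\epsilon_2\epsilon_5t^2u^3)$ 33. $[x_{3a+b}(u),x_{-a}(t)]=x_{2a+b}(-\epsilon_3tu)\,x_{a+b}(\epsilon_2\epsilon_3t^2u)\,x_{b}(-\epsilon_1\epsilon_2\epsilon_3t^3u)\,x_{3a+2b}(\epsilon_2\epsilon_5t^3u^2)$ 34. $[x_{-2a-b}(u),x_{3a+b}(t)]=x_{a}(-\epsilon_3tu)\,x_{-a-b}(\epsilon_2\epsilon_3tu^2)\,x_{-3a-2b}(\epsilon_2\epsilon_3\epsilon_5tu^3)\,x_{-b}(-2\epsilon_1\epsilon_2t^2u^3)$ 35. $[x_{3a+b}(u),x_{-2a-b}(t)]=x_{a}(\epsilon_3tu)\,x_{-a-b}(-\epsilon_2\epsilon_3t^2u)\,x_{-3a-2b}(-\epsilon_2\epsilon_3\epsilon_5t^3u)\,x_{-b}(-\epsilon_1\epsilon_2t^3u^2)$ 36. $[x_{-3a-2b}(u),x_{3a+b}(t)]=x_{-b}(-\epsilon_4tu)$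 37. $[x_{-a-b}(u),x_{3a+2b}(t)]=x_{2a+b}(-\epsilon_5tu)\,x_{a}(-\epsilon_2\epsilon_5tu^2)\,x_{-b}(\epsilon_1\epsilon_2\epsilon_5tu^3)\,x_{3a+b}(2\epsilon_2\epsilon_3t^2u^3)$ 38. $[x_{3a+2b}(u),x_{-a-b}(t)]=x_{2a+b}(\epsilon_5tu)\,x_{a}(\epsilon_2\epsilon_5t^2u)\,x_{-b}(-\epsilon_1\epsilon_2\epsilon_5t^3u)\,x_{3a+b}(\epsilon_2\epsilon_3t^3u^2)$ 39. $[x_{-2a-b}(u),x_{3a+2b}(t)]=x_{a+b}(\epsilon_5tu)\,x_{-a}(\epsilon_2\epsilon_5tu^2)\,x_{-3a-b}(-\epsilon_2\epsilon_3\epsilon_5tu^3)\,x_{b}(2\epsilon_1\epsilon_2t^2u^3)$ 40. $[x_{3a+2b}(u),x_{-2a-b}(t)]=x_{a+b}(-\epsilon_5tu)\,x_{-a}(-\epsilon_2\epsilon_5t^2u)\,x_{-3a-b}(\epsilon_2\epsilon_3\epsilon_5t^3u)\,x_{b}(\epsilon_1\epsilon_2t^3u^2)$ 41. $[x_{-3a-b}(u),x_{3a+2b}(t)]=x_{b}(-\epsilon_4tu)$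 42. $[x_{b}(u),x_{-3a-2b}(t)]=x_{-3a-b}(-\epsilon_4tu)$ 43. $[x_{3a+b}(u),x_{-3a-2b}(t)]=x_{-b}(\epsilon_4tu)$ 44. $[x_{-b}(u),x_{-3a-b}(t)]=x_{-3a-2b}(-\epsilon_4tu)$ 45. $[x_{3a+2b}(u),x_{-3a-b}(t)]=x_{b}(\epsilon_4tu)$ 46. $[x_{-a-b}(u),x_{-2a-b}(t)]=x_{-3a-2b}(3\epsilon_5tu)$ 47. $[x_{-a}(u),x_{-2a-b}(t)]=x_{-3a-b}(-3\epsilon_3tu)$ 48. $[x_{a}(u),x_{-2a-b}(t)]=x_{-a-b}(-2\epsilon_2tu)\,x_{-3a-2b}(-3\epsilon_2\epsilon_5t^2u)\,x_{-b}(-3\epsilon_1\epsilon_2tu^2)$ 49. $[x_{a+b}(u),x_{-2a-b}(t)]=x_{-a}(2\epsilon_2tu)\,x_{-3a-b}(-3\epsilon_2\epsilon_3t^2u)\,x_{b}(3\epsilon_1\epsilon_2tu^2)$ 50. $[x_{-a}(u),x_{-a-b}(t)]=x_{-2a-b}(-2\epsilon_2tu)\,x_{-3a-2b}(3\epsilon_2\epsilon_5t^2u)\,x_{-3a-b}(-3\epsilon_2\epsilon_3tu^2)$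 51. $[x_{a}(u),x_{-a-b}(t)]=x_{-b}(-3\epsilon_1tu)$ 52. $[x_{2a+b}(u),x_{-a-b}(t)]=x_{a}(2\epsilon_2tu)\,x_{-b}(-3\epsilon_1\epsilon_2t^2u)\,x_{3a+b}(3\epsilon_2\epsilon_3tu^2)$ 53. $[x_{a+b}(u),x_{-a}(t)]=x_{b}(-3\epsilon_1tu)$ 54. $[x_{2a+b}(u),x_{-a}(t)]=x_{a+b}(-2\epsilon_2tu)\,x_{b}(3\epsilon_1\epsilon_2t^2u)\,x_{3a+2b}(3\epsilon_2\epsilon_5tu^2)$ 55. $[x_{3a+2b}(u),x_{-b}(t)]=x_{3a+b}(-\epsilon_4tu)$ 56. $[x_{a}(u),x_{a+b}(t)]=x_{2a+b}(2\epsilon_2tu)\,x_{3a+2b}(3\epsilon_2\epsilon_5t^2u)\,x_{3a+b}(-3\epsilon_2\epsilon_3tu^2)$ 57. $[x_{a}(u),x_{2a+b}(t)]=x_{3a+b}(3\epsilon_3tu)$ 58. $[x_{a+b}(u),x_{2a+b}(t)]=x_{3a+2b}(-3\epsilon_5tu)$ 59. $[x_{b}(u),x_{3a+b}(t)]=x_{3a+2b}(\epsilon_4tu)$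 60. $[x_{-b}(u),x_{3a+2b}(t)]=x_{3a+b}(\epsilon_4tu)$ -/

import Mathlib

namespace G2

open Module TensorProduct

section LieAlgebra

open LieAlgebra.IsKilling (rootSystem)

variable {L : Type*} [LieRing L] [LieAlgebra ℂ L] [FiniteDimensional ℂ L]
  [LieAlgebra.IsSimple ℂ L]

/-- The set of roots of a complex simple Lie algebra with respect to a Cartan subalgebra `H`,
as linear forms on `H`. -/
abbrev roots (H : LieSubalgebra ℂ L) [H.IsCartanSubalgebra] : Set (Dual ℂ H) :=
  Set.range (rootSystem H).root

/-- `a` and `b` are roots with `2 (b, a) / (a, a) = -3`. As the Lie algebra is simple, this says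
that its root system has type `G₂` and that `a`, `b` are fundamental roots, `a` being short. -/
def IsFundamentalPair (H : LieSubalgebra ℂ L) [H.IsCartanSubalgebra] (a b : Dual ℂ H) : Prop :=
  ∃ i j : H.root, (rootSystem H).root i = a ∧
    (rootSystem H).root j = b ∧
    (rootSystem H).pairing j i = -3

/-- A Chevalley basis of a complex simple Lie algebra: root vectors `e r` with
`[e r, e (-r)] = h r` (the coroot of `r`) and `[e r, e s] = ± (p + 1) e (r + s)` whenever
`r`, `s`, `r + s` are roots, where `p` is the greatest integer for which `s - p r` is a root.
The basis itself consists of all `e r` and of the `h r` with `r` fundamental. The `N r s` are the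
structure constants. For convenience `e` and `N` are extended by zero
to linear forms that are not roots. -/
structure ChevalleyBasis (H : LieSubalgebra ℂ L) [H.IsCartanSubalgebra] where
  /-- the root vectors -/
  e : Dual ℂ H → L
  /-- the structure constants -/
  N : Dual ℂ H → Dual ℂ H → ℤ
  e_mem : ∀ r ∈ roots H, e r ∈ LieAlgebra.rootSpace H r
  lie_e_neg : ∀ i : H.root, ⁅e ((rootSystem H).root i),
    e (-(rootSystem H).root i)⁆ =
      ((rootSystem H).coroot i : L)
  lie_e_e : ∀ r ∈ roots H, ∀ s ∈ roots H, r + s ∈ roots H → ⁅e r, e s⁆ = N r s • e (r + s)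
  abs_N : ∀ i j : H.root, (rootSystem H).root i +
      (rootSystem H).root j ∈ roots H →
    |N ((rootSystem H).root i)
      ((rootSystem H).root j)| =
        (rootSystem H).chainBotCoeff i j + 1
  e_eq_zero : ∀ r, r ∉ roots H → e r = 0
  N_eq_zero : ∀ r s, ¬ (r ∈ roots H ∧ s ∈ roots H ∧ r + s ∈ roots H) → N r s = 0

namespace ChevalleyBasis

variable {H : LieSubalgebra ℂ L} [H.IsCartanSubalgebra] (B : ChevalleyBasis H)

/-- The lattice `L_ℤ` spanned over `ℤ` by the Chevalley basis. (Every coroot is an integral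
combination of the fundamental ones, so that all of them may be listed here.) -/
def lattice : Submodule ℤ L :=
  Submodule.span ℤ (B.e '' roots H ∪
    Set.range fun i : H.root => ((rootSystem H).coroot i : L))

/-- The operator `(ad e_r)ⁿ / n!` on `L`. -/
noncomputable def adDiv (r : Dual ℂ H) (n : ℕ) : L →ₗ[ℂ] L :=
  (n.factorial : ℂ)⁻¹ • (LieAlgebra.ad ℂ L (B.e r)) ^ n

lemma e_mem_lattice (r : Dual ℂ H) : B.e r ∈ B.lattice := by
  by_cases hr : r ∈ roots H
  · exact Submodule.subset_span (Or.inl ⟨r, hr, rfl⟩)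
  · rw [B.e_eq_zero r hr]; exact zero_mem _

lemma coroot_mem_lattice (i : H.root) : ((rootSystem H).coroot i : L) ∈ B.lattice :=
  Submodule.subset_span (Or.inr ⟨i, rfl⟩)

lemma lie_eq_zero {r s : Dual ℂ H} (hr : r ∈ roots H) (hs : s ∈ roots H) (h0 : r + s ≠ 0)
    (hrs : r + s ∉ roots H) : ⁅B.e r, B.e s⁆ = 0 := by
  have h := LieAlgebra.lie_mem_genWeightSpace_of_mem_genWeightSpace (B.e_mem r hr) (B.e_mem s hs)
  by_contra hne
  have hbot : LieModule.genWeightSpace L ((r : H → ℂ) + (s : H → ℂ)) ≠ ⊥ := by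
    intro hb
    rw [hb] at h
    exact hne (by simpa using h)
  let W : LieModule.Weight ℂ H L := ⟨_, hbot⟩
  have hW : W.IsNonZero := fun hz => h0 (LinearMap.ext fun x => congrFun hz x)
  exact hrs ⟨⟨W, by simpa using hW⟩, LinearMap.ext fun x => rfl⟩

lemma lie_coroot (i : H.root) {r : Dual ℂ H} (hr : r ∈ roots H) :
    ⁅B.e r, ((rootSystem H).coroot i : L)⁆ =
      -(r ((rootSystem H).coroot i) • B.e r) := by
  rw [← lie_skew]
  congr 1
  exact LieAlgebra.IsKilling.lie_eq_smul_of_mem_rootSpace (B.e_mem r hr) _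

lemma exists_int (i : H.root) {r : Dual ℂ H} (hr : r ∈ roots H) :
    ∃ m : ℤ, r ((rootSystem H).coroot i) = m := by
  obtain ⟨j, rfl⟩ := hr
  obtain ⟨m, hm⟩ := (rootSystem H).exists_value (S := ℤ) j i
  exact ⟨m, by simpa using hm.symm⟩

lemma ad_pow_e (i j : H.root)
    (hij : LinearIndependent ℂ ![(rootSystem H).root i,
      (rootSystem H).root j]) (n : ℕ) :
    (LieAlgebra.ad ℂ L (B.e ((rootSystem H).root i)) ^ n)
        (B.e ((rootSystem H).root j)) = 0 ∨
      ∃ (k : H.root) (m : ℤ),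
        LinearIndependent ℂ ![(rootSystem H).root i,
          (rootSystem H).root k] ∧
        (rootSystem H).chainBotCoeff i k =
          (rootSystem H).chainBotCoeff i j + n ∧
        |m| = ((rootSystem H).chainBotCoeff i j + 1).ascFactorial n ∧
        (LieAlgebra.ad ℂ L (B.e ((rootSystem H).root i)) ^ n)
          (B.e ((rootSystem H).root j)) =
            m • B.e ((rootSystem H).root k) := by
  induction n with
  | zero => exact Or.inr ⟨j, 1, hij, by simp, by simp, by simp⟩
  | succ n ih =>
    rcases ih with h | ⟨k, m, hik, hc, hm, h⟩
    · left; rw [pow_succ', Module.End.mul_apply, h, map_zero]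
    · rw [pow_succ', Module.End.mul_apply, h, map_zsmul, LieAlgebra.ad_apply]
      by_cases hk : (rootSystem H).root i + (rootSystem H).root k ∈ roots H
      · right
        obtain ⟨l, hl⟩ := id hk
        have hl' : (rootSystem H).root l = (rootSystem H).root k + (rootSystem H).root i := by rw [hl, add_comm]
        refine ⟨l, m * B.N ((rootSystem H).root i) ((rootSystem H).root k), ?_, ?_, ?_, ?_⟩
        · rw [hl', add_comm]; simpa [-LieAlgebra.IsKilling.rootSystem_root_apply] using hik
        · rw [RootPairing.chainBotCoeff_of_add hik hl', hc]; ring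
        · rw [abs_mul, hm, B.abs_N i k hk, hc, Nat.ascFactorial_succ]
          push_cast; ring
        · rw [B.lie_e_e _ ⟨i, rfl⟩ _ ⟨k, rfl⟩ hk, smul_smul, hl', add_comm]
      · left
        rw [B.lie_eq_zero ⟨i, rfl⟩ ⟨k, rfl⟩ _ hk, smul_zero]
        intro h0
        have := LinearIndependent.pair_iff.1 hik 1 1 (by simpa [-LieAlgebra.IsKilling.rootSystem_root_apply] using h0)
        exact one_ne_zero this.1

lemma adDiv_e_mem (r s : Dual ℂ H) (n : ℕ) : B.adDiv r n (B.e s) ∈ B.lattice := by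
  rcases Nat.eq_zero_or_pos n with rfl | hn
  · simpa [-LieAlgebra.IsKilling.rootSystem_root_apply, -LieAlgebra.IsKilling.rootSystem_coroot_apply,
        adDiv] using B.e_mem_lattice s
  by_cases hr : r ∈ roots H
  swap
  · simp [-LieAlgebra.IsKilling.rootSystem_root_apply, -LieAlgebra.IsKilling.rootSystem_coroot_apply,
        adDiv, B.e_eq_zero r hr, hn.ne']
  by_cases hs : s ∈ roots H
  swap
  · simp [B.e_eq_zero s hs]
  obtain ⟨i, rfl⟩ := hr
  obtain ⟨j, rfl⟩ := hs
  by_cases h1 : i = j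
  · subst h1
    obtain ⟨m, rfl⟩ := Nat.exists_eq_succ_of_ne_zero hn.ne'
    simp [-LieAlgebra.IsKilling.rootSystem_root_apply, -LieAlgebra.IsKilling.rootSystem_coroot_apply,
        adDiv, pow_succ]
  by_cases h2 : (rootSystem H).root i = -(rootSystem H).root j
  · have h2' : (rootSystem H).root j = -(rootSystem H).root i := by rw [h2, neg_neg]
    have hi : ((rootSystem H).coroot i : L) ∈ B.lattice := Submodule.subset_span (Or.inr ⟨i, rfl⟩)
    have e1 := B.lie_e_neg i
    have e2 := B.lie_coroot i (r := (rootSystem H).root i) ⟨i, rfl⟩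
    have e3 : (rootSystem H).root i ((rootSystem H).coroot i) = 2 := (rootSystem H).root_coroot_two i
    rw [e3] at e2
    rw [h2']
    rcases n with _ | _ | _ | n
    · omega
    · simpa [-LieAlgebra.IsKilling.rootSystem_root_apply, -LieAlgebra.IsKilling.rootSystem_coroot_apply,
        adDiv, e1] using hi
    · have : B.adDiv ((rootSystem H).root i) 2 (B.e (-(rootSystem H).root i)) = -B.e ((rootSystem H).root i) := by
        simp [-LieAlgebra.IsKilling.rootSystem_root_apply, -LieAlgebra.IsKilling.rootSystem_coroot_apply,
        adDiv, pow_succ, e1, e2, Nat.factorial]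
      rw [this]
      exact neg_mem (B.e_mem_lattice _)
    · simp [-LieAlgebra.IsKilling.rootSystem_root_apply, -LieAlgebra.IsKilling.rootSystem_coroot_apply,
        adDiv, pow_succ, e1, e2]
  · have hij : LinearIndependent ℂ ![(rootSystem H).root i, (rootSystem H).root j] :=
      RootPairing.IsReduced.linearIndependent (rootSystem H) h1 h2
    rcases B.ad_pow_e i j hij n with h | ⟨k, m, -, -, hm, h⟩
    · simp [-LieAlgebra.IsKilling.rootSystem_root_apply, -LieAlgebra.IsKilling.rootSystem_coroot_apply,
        adDiv, h]
    · have hd : (n.factorial : ℤ) ∣ m := by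
        rw [← dvd_abs, hm]
        exact_mod_cast Nat.factorial_dvd_ascFactorial _ _
      obtain ⟨c, rfl⟩ := hd
      have hf : (n.factorial : ℂ) ≠ 0 := by exact_mod_cast n.factorial_ne_zero
      have : B.adDiv ((rootSystem H).root i) n (B.e ((rootSystem H).root j)) = c • B.e ((rootSystem H).root k) := by
        rw [adDiv, LinearMap.smul_apply, h, ← Int.cast_smul_eq_zsmul ℂ, smul_smul,
          ← Int.cast_smul_eq_zsmul ℂ]
        push_cast
        rw [inv_mul_cancel_left₀ hf]
      rw [this]
      exact Submodule.smul_mem _ _ (B.e_mem_lattice _)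

lemma adDiv_coroot_mem (r : Dual ℂ H) (i : H.root) (n : ℕ) :
    B.adDiv r n ((rootSystem H).coroot i : L) ∈ B.lattice := by
  by_cases hr : r ∈ roots H
  · obtain ⟨m, hm⟩ := exists_int i hr
    have e1 := B.lie_coroot i hr
    rw [hm, Int.cast_smul_eq_zsmul] at e1
    rcases n with _ | _ | n
    · simpa [-LieAlgebra.IsKilling.rootSystem_root_apply, -LieAlgebra.IsKilling.rootSystem_coroot_apply,
        adDiv] using B.coroot_mem_lattice i
    · simpa [-LieAlgebra.IsKilling.rootSystem_root_apply, -LieAlgebra.IsKilling.rootSystem_coroot_apply,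
        adDiv, e1] using Submodule.smul_mem _ m (B.e_mem_lattice r)
    · simp [-LieAlgebra.IsKilling.rootSystem_root_apply, -LieAlgebra.IsKilling.rootSystem_coroot_apply,
        adDiv, pow_succ, e1]
  · rcases Nat.eq_zero_or_pos n with rfl | hn
    · simpa [-LieAlgebra.IsKilling.rootSystem_root_apply, -LieAlgebra.IsKilling.rootSystem_coroot_apply,
        adDiv] using B.coroot_mem_lattice i
    · simp [-LieAlgebra.IsKilling.rootSystem_root_apply, -LieAlgebra.IsKilling.rootSystem_coroot_apply,
        adDiv, B.e_eq_zero r hr, hn.ne']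

lemma adDiv_mem (r : Dual ℂ H) (n : ℕ) (v : L) (hv : v ∈ B.lattice) :
    B.adDiv r n v ∈ B.lattice := by
  induction hv using Submodule.span_induction with
  | mem v hv =>
    rcases hv with ⟨s, -, rfl⟩ | ⟨i, rfl⟩
    · exact B.adDiv_e_mem r s n
    · exact B.adDiv_coroot_mem r i n
  | zero => simp
  | add v w _ _ hv hw => simpa using add_mem hv hw
  | smul c v _ hv => simpa using Submodule.smul_mem _ c hv

/-- The operator `(ad e_r)ⁿ / n!` on the lattice `L_ℤ`. -/
noncomputable def latticeDiv (r : Dual ℂ H) (n : ℕ) : B.lattice →ₗ[ℤ] B.lattice :=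
  ((B.adDiv r n).restrictScalars ℤ).restrict (B.adDiv_mem r n)

lemma isNilpotent_ad (r : Dual ℂ H) : IsNilpotent (LieAlgebra.ad ℂ L (B.e r)) := by
  by_cases hr : r ∈ roots H
  · have h0 : (r : H → ℂ) ≠ 0 := by
      obtain ⟨i, rfl⟩ := hr
      intro h
      exact (rootSystem H).ne_zero i (LinearMap.ext fun x => congrFun h x)
    exact LieAlgebra.isNilpotent_ad_of_mem_rootSpace H h0 (B.e_mem r hr)
  · simp [B.e_eq_zero r hr]

lemma latticeDiv_zero (r : Dual ℂ H) : B.latticeDiv r 0 = 1 := by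
  ext v; simp [latticeDiv, adDiv]

lemma latticeDiv_eq_zero (r : Dual ℂ H) {n : ℕ}
    (hn : nilpotencyClass (LieAlgebra.ad ℂ L (B.e r)) ≤ n) : B.latticeDiv r n = 0 := by
  ext v
  simp [latticeDiv, adDiv, pow_eq_zero_of_le hn (pow_nilpotencyClass (B.isNilpotent_ad r))]

lemma latticeDiv_mul (r : Dual ℂ H) (m n : ℕ) :
    B.latticeDiv r m * B.latticeDiv r n = ((m + n).choose m) • B.latticeDiv r (m + n) := by
  have h : B.adDiv r m * B.adDiv r n = ((m + n).choose m : ℂ) • B.adDiv r (m + n) := by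
    rw [adDiv, adDiv, adDiv, smul_mul_smul_comm, ← pow_add, smul_smul]
    congr 1
    have h1 : (m.factorial : ℂ) ≠ 0 := by exact_mod_cast m.factorial_ne_zero
    have h2 : (n.factorial : ℂ) ≠ 0 := by exact_mod_cast n.factorial_ne_zero
    have h3 : ((m + n).factorial : ℂ) ≠ 0 := by exact_mod_cast (m + n).factorial_ne_zero
    have h4 : ((m + n).choose m : ℂ) * m.factorial * n.factorial = (m + n).factorial := by
      rw [Nat.choose_symm_add]
      exact_mod_cast Nat.add_choose_mul_factorial_mul_factorial m n
    field_simp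
    rw [← h4]; ring
  ext v
  have := LinearMap.congr_fun h (v : L)
  rw [Nat.cast_smul_eq_nsmul] at this
  exact this

variable (K : Type*) [CommRing K]

/-- The operator `x_r(t) = exp (t ad e_r) = ∑ tⁿ (ad e_r)ⁿ / n!` on `L_K = K ⊗ L_ℤ`. -/
noncomputable def expEnd (r : Dual ℂ H) (t : K) : Module.End K (K ⊗[ℤ] B.lattice) :=
  ∑ n ∈ Finset.range (nilpotencyClass (LieAlgebra.ad ℂ L (B.e r))),
    t ^ n • (B.latticeDiv r n).baseChange K

lemma expEnd_zero (r : Dual ℂ H) : B.expEnd K r 0 = 1 := by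
  have h : nilpotencyClass (LieAlgebra.ad ℂ L (B.e r)) ≠ 0 := by
    have : Nontrivial L := by
      by_contra h
      have : Subsingleton L := not_nontrivial_iff_subsingleton.1 h
      exact LieAlgebra.IsSimple.non_abelian ℂ (L := L) ⟨fun x y => Subsingleton.elim _ _⟩
    exact (pos_nilpotencyClass_iff.2 (B.isNilpotent_ad r)).ne'
  obtain ⟨k, hk⟩ := Nat.exists_eq_succ_of_ne_zero h
  rw [expEnd, hk, Finset.sum_range_succ']
  simp [latticeDiv_zero]

lemma expEnd_add (r : Dual ℂ H) (s t : K) :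
    B.expEnd K r (s + t) = B.expEnd K r s * B.expEnd K r t := by
  set k := nilpotencyClass (LieAlgebra.ad ℂ L (B.e r)) with hk
  have hmul : ∀ i j : ℕ, (s ^ i • (B.latticeDiv r i).baseChange K) *
      (t ^ j • (B.latticeDiv r j).baseChange K) =
        (s ^ i * t ^ j * ((i + j).choose i : K)) • (B.latticeDiv r (i + j)).baseChange K := by
    intro i j
    rw [smul_mul_smul_comm, Module.End.mul_eq_comp, ← LinearMap.baseChange_comp,
      ← Module.End.mul_eq_comp, latticeDiv_mul, mul_smul (s ^ i * t ^ j)]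
    congr 1
    rw [← Nat.cast_smul_eq_nsmul ℤ, LinearMap.baseChange_smul, Nat.cast_smul_eq_nsmul,
      Nat.cast_smul_eq_nsmul]
  have hR : B.expEnd K r s * B.expEnd K r t = ∑ i ∈ Finset.range k, ∑ j ∈ Finset.range (k - i),
      (s ^ i * t ^ j * ((i + j).choose i : K)) • (B.latticeDiv r (i + j)).baseChange K := by
    rw [expEnd, expEnd, Finset.sum_mul_sum]
    refine Finset.sum_congr rfl fun i _ => ?_
    simp only [hmul]
    symm
    refine Finset.sum_subset (Finset.range_mono (Nat.sub_le k i)) fun j _ hj => ?_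
    rw [B.latticeDiv_eq_zero r (n := i + j) (by rw [Finset.mem_range] at hj; omega)]
    simp
  rw [hR, ← Finset.sum_range_diag_flip k fun i j =>
    (s ^ i * t ^ j * ((i + j).choose i : K)) • (B.latticeDiv r (i + j)).baseChange K, expEnd]
  refine Finset.sum_congr rfl fun n _ => ?_
  rw [add_pow, Finset.sum_smul]
  refine Finset.sum_congr rfl fun i hi => ?_
  rw [Nat.add_sub_cancel' (Finset.mem_range_succ_iff.1 hi)]

/-- The root element `x_r(t)` as an invertible operator on `L_K`. -/
noncomputable def expUnit (r : Dual ℂ H) (t : K) :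
    LinearMap.GeneralLinearGroup K (K ⊗[ℤ] B.lattice) where
  val := B.expEnd K r t
  inv := B.expEnd K r (-t)
  val_inv := by rw [← expEnd_add, add_neg_cancel, expEnd_zero]
  inv_val := by rw [← expEnd_add, neg_add_cancel, expEnd_zero]

/-- The Chevalley group over `K`: the group of operators on `L_K` generated by all `x_r(t)`,
where `r` is a root and `t ∈ K`. -/
def chevalleyGroup : Subgroup (LinearMap.GeneralLinearGroup K (K ⊗[ℤ] B.lattice)) :=
  Subgroup.closure {g | ∃ r ∈ roots H, ∃ t : K, B.expUnit K r t = g}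

lemma expUnit_mem (r : Dual ℂ H) (t : K) : B.expUnit K r t ∈ B.chevalleyGroup K := by
  by_cases hr : r ∈ roots H
  · exact Subgroup.subset_closure ⟨r, hr, t, rfl⟩
  · have h : B.expUnit K r t = 1 := by
      have hn : ∀ n ≠ 0, B.latticeDiv r n = 0 := fun n hn => by
        ext v; simp [latticeDiv, adDiv, B.e_eq_zero r hr, hn]
      ext1
      change B.expEnd K r t = 1
      rw [← B.expEnd_zero K r, expEnd, expEnd]
      refine Finset.sum_congr rfl fun n _ => ?_
      rcases eq_or_ne n 0 with rfl | h0
      · simp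
      · simp [hn n h0]
    rw [h]
    exact one_mem _

variable {K} in
/-- The root element `x_r(t)` of the Chevalley group over `K`. (It is the identity if the linear
form `r` is not a root.) -/
noncomputable def x (r : Dual ℂ H) (t : K) : B.chevalleyGroup K :=
  ⟨B.expUnit K r t, B.expUnit_mem K r t⟩

/-- `M_{r,s,i} = N_{r,s} N_{r,r+s} ⋯ N_{r,(i-1)r+s} / i!`. -/
def M (r s : Dual ℂ H) (i : ℕ) : ℚ :=
  (∏ k ∈ Finset.range i, (B.N r (k • r + s) : ℚ)) / i.factorial

/-- The constants `C_{ij,rs}` of Chevalley's commutator formula. -/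
def C (i j : ℕ) (r s : Dual ℂ H) : ℚ :=
  match i, j with
  | i, 1 => B.M r s i
  | 1, j => (-1) ^ j * B.M s r j
  | 3, 2 => 1 / 3 * B.M (r + s) r 2
  | 2, 3 => -(2 / 3) * B.M (s + r) s 2
  | _, _ => 0


end ChevalleyBasis

/-- The commutator `[g, h] = g⁻¹ h⁻¹ g h`. -/
def comm {G : Type*} [Group G] (g h : G) : G := g⁻¹ * h⁻¹ * g * h

/-- The pairs `(i, j)` in the order of the factors of Chevalley's commutator formula
(increasing `i + j`). -/
def orderedPairs : List (ℕ × ℕ) := [(1, 1), (2, 1), (1, 2), (3, 1), (1, 3), (3, 2), (2, 3)]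

open Classical in
/-- The product of the root elements `x_{ir+js}(c_{ij} (-t)^i u^j)` over all pairs `(i, j)` of the
list for which `i r + j s` is a root, in the order of the list. -/
noncomputable def rootProduct {H : LieSubalgebra ℂ L} [H.IsCartanSubalgebra]
    (B : ChevalleyBasis H) {K : Type*} [CommRing K] (c : ℕ → ℕ → ℤ) (r s : Dual ℂ H) (t u : K) :
    B.chevalleyGroup K :=
  ((orderedPairs.filter fun p => p.1 • r + p.2 • s ∈ roots H).map fun p =>
    B.x (p.1 • r + p.2 • s) ((c p.1 p.2 : K) * (-t) ^ p.1 * u ^ p.2)).prod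

end LieAlgebra

/-- `C_{ij,rs} = c` for all entries `((i, j), c)` of the list `l`. -/
def ConstantsAre {V : Type*} (C : ℕ → ℕ → V → V → ℚ) (r s : V) (l : List ((ℕ × ℕ) × ℚ)) : Prop :=
  ∀ p ∈ l, C p.1.1 p.1.2 r s = p.2

/-- The values of all constants `C_{ij,rs}` in type `G₂` (`a` short, `b` long). -/
def ConstantTable {V : Type*} [AddCommGroup V] (C : ℕ → ℕ → V → V → ℚ) (a b : V)
    (ε₁ ε₂ ε₃ ε₄ ε₅ : ℚ) : Prop :=
  ConstantsAre C a b [((1, 1), ε₁), ((2, 1), ε₁ * ε₂), ((3, 1), ε₁ * ε₂ * ε₃), ((3, 2), ε₂ * ε₅)] ∧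
  ConstantsAre C b a [((1, 1), -ε₁), ((1, 2), ε₁ * ε₂), ((1, 3), -ε₁ * ε₂ * ε₃), ((2, 3), -2 * ε₂ * ε₅)] ∧
  ConstantsAre C a (a + b) [((1, 1), 2 * ε₂), ((2, 1), 3 * ε₂ * ε₃), ((1, 2), 3 * ε₂ * ε₅)] ∧
  ConstantsAre C a ((2 : ℕ) • a + b) [((1, 1), 3 * ε₃)] ∧
  ConstantsAre C b ((3 : ℕ) • a + b) [((1, 1), ε₄)] ∧
  ConstantsAre C (a + b) ((2 : ℕ) • a + b) [((1, 1), -3 * ε₅)] ∧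
  ConstantsAre C (-a) (-b) [((1, 1), -ε₁), ((2, 1), ε₁ * ε₂), ((3, 1), -ε₁ * ε₂ * ε₃), ((3, 2), ε₂ * ε₅)] ∧
  ConstantsAre C (-b) (-a) [((1, 1), ε₁), ((1, 2), ε₁ * ε₂), ((1, 3), ε₁ * ε₂ * ε₃), ((2, 3), -2 * ε₂ * ε₅)] ∧
  ConstantsAre C (-a) (-a - b) [((1, 1), -2 * ε₂), ((2, 1), 3 * ε₂ * ε₃), ((1, 2), 3 * ε₂ * ε₅)] ∧
  ConstantsAre C (-a) (-((2 : ℕ) • a) - b) [((1, 1), -3 * ε₃)] ∧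
  ConstantsAre C (-b) (-((3 : ℕ) • a) - b) [((1, 1), -ε₄)] ∧
  ConstantsAre C (-a - b) (-((2 : ℕ) • a) - b) [((1, 1), 3 * ε₅)] ∧
  ConstantsAre C a (-a - b) [((1, 1), -3 * ε₁)] ∧
  ConstantsAre C a (-((2 : ℕ) • a) - b) [((1, 1), -2 * ε₂), ((2, 1), 3 * ε₁ * ε₂), ((1, 2), -3 * ε₂ * ε₅)] ∧
  ConstantsAre C a (-((3 : ℕ) • a) - b) [((1, 1), -ε₃), ((2, 1), ε₂ * ε₃), ((3, 1), -ε₁ * ε₂ * ε₃), ((3, 2), -ε₂ * ε₅)] ∧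
  ConstantsAre C (-((3 : ℕ) • a) - b) a [((1, 1), ε₃), ((1, 2), ε₂ * ε₃), ((1, 3), ε₁ * ε₂ * ε₃), ((2, 3), 2 * ε₂ * ε₅)] ∧
  ConstantsAre C (-a - b) b [((1, 1), -ε₁), ((2, 1), -ε₁ * ε₂), ((3, 1), -ε₁ * ε₂ * ε₅), ((3, 2), ε₂ * ε₃)] ∧
  ConstantsAre C b (-a - b) [((1, 1), ε₁), ((1, 2), -ε₁ * ε₂), ((1, 3), ε₁ * ε₂ * ε₅), ((2, 3), -2 * ε₂ * ε₃)] ∧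
  ConstantsAre C b (-((3 : ℕ) • a) - (2 : ℕ) • b) [((1, 1), -ε₄)] ∧
  ConstantsAre C (a + b) (-a) [((1, 1), -3 * ε₁)] ∧
  ConstantsAre C (a + b) (-b) [((1, 1), ε₁), ((2, 1), -ε₁ * ε₂), ((3, 1), ε₁ * ε₂ * ε₅), ((3, 2), ε₂ * ε₃)] ∧
  ConstantsAre C (-b) (a + b) [((1, 1), -ε₁), ((1, 2), -ε₁ * ε₂), ((1, 3), -ε₁ * ε₂ * ε₅), ((2, 3), -2 * ε₂ * ε₃)] ∧
  ConstantsAre C (a + b) (-((2 : ℕ) • a) - b) [((1, 1), 2 * ε₂), ((2, 1), -3 * ε₁ * ε₂), ((1, 2), -3 * ε₂ * ε₃)] ∧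
  ConstantsAre C (a + b) (-((3 : ℕ) • a) - (2 : ℕ) • b) [((1, 1), ε₅), ((2, 1), ε₂ * ε₅), ((3, 1), -ε₁ * ε₂ * ε₅), ((3, 2), -ε₂ * ε₃)] ∧
  ConstantsAre C (-((3 : ℕ) • a) - (2 : ℕ) • b) (a + b) [((1, 1), -ε₅), ((1, 2), ε₂ * ε₅), ((1, 3), ε₁ * ε₂ * ε₅), ((2, 3), 2 * ε₂ * ε₃)] ∧
  ConstantsAre C ((2 : ℕ) • a + b) (-a) [((1, 1), -2 * ε₂), ((2, 1), -3 * ε₂ * ε₅), ((1, 2), 3 * ε₁ * ε₂)] ∧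
  ConstantsAre C ((2 : ℕ) • a + b) (-a - b) [((1, 1), 2 * ε₂), ((2, 1), -3 * ε₂ * ε₃), ((1, 2), -3 * ε₁ * ε₂)] ∧
  ConstantsAre C ((2 : ℕ) • a + b) (-((3 : ℕ) • a) - b) [((1, 1), ε₃), ((2, 1), -ε₂ * ε₃), ((3, 1), -ε₂ * ε₃ * ε₅), ((3, 2), ε₁ * ε₂)] ∧
  ConstantsAre C (-((3 : ℕ) • a) - b) ((2 : ℕ) • a + b) [((1, 1), -ε₃), ((1, 2), -ε₂ * ε₃), ((1, 3), ε₂ * ε₃ * ε₅), ((2, 3), -2 * ε₁ * ε₂)] ∧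
  ConstantsAre C ((2 : ℕ) • a + b) (-((3 : ℕ) • a) - (2 : ℕ) • b) [((1, 1), -ε₅), ((2, 1), -ε₂ * ε₅), ((3, 1), ε₂ * ε₃ * ε₅), ((3, 2), -ε₁ * ε₂)] ∧
  ConstantsAre C (-((3 : ℕ) • a) - (2 : ℕ) • b) ((2 : ℕ) • a + b) [((1, 1), ε₅), ((1, 2), -ε₂ * ε₅), ((1, 3), -ε₂ * ε₃ * ε₅), ((2, 3), 2 * ε₁ * ε₂)] ∧
  ConstantsAre C ((3 : ℕ) • a + b) (-a) [((1, 1), -ε₃), ((1, 2), ε₂ * ε₃), ((1, 3), -ε₁ * ε₂ * ε₃), ((2, 3), 2 * ε₂ * ε₅)] ∧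
  ConstantsAre C (-a) ((3 : ℕ) • a + b) [((1, 1), ε₃), ((2, 1), ε₂ * ε₃), ((3, 1), ε₁ * ε₂ * ε₃), ((3, 2), -ε₂ * ε₅)] ∧
  ConstantsAre C ((3 : ℕ) • a + b) (-((2 : ℕ) • a) - b) [((1, 1), ε₃), ((1, 2), -ε₂ * ε₃), ((1, 3), -ε₂ * ε₃ * ε₅), ((2, 3), -2 * ε₁ * ε₂)] ∧
  ConstantsAre C (-((2 : ℕ) • a) - b) ((3 : ℕ) • a + b) [((1, 1), -ε₃), ((2, 1), -ε₂ * ε₃), ((3, 1), ε₂ * ε₃ * ε₅), ((3, 2), ε₁ * ε₂)] ∧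
  ConstantsAre C ((3 : ℕ) • a + b) (-((3 : ℕ) • a) - (2 : ℕ) • b) [((1, 1), ε₄)] ∧
  ConstantsAre C ((3 : ℕ) • a + (2 : ℕ) • b) (-a - b) [((1, 1), ε₅), ((1, 2), ε₂ * ε₅), ((1, 3), -ε₁ * ε₂ * ε₅), ((2, 3), 2 * ε₂ * ε₃)] ∧
  ConstantsAre C (-a - b) ((3 : ℕ) • a + (2 : ℕ) • b) [((1, 1), -ε₅), ((2, 1), ε₂ * ε₅), ((3, 1), ε₁ * ε₂ * ε₅), ((3, 2), -ε₂ * ε₃)] ∧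
  ConstantsAre C ((3 : ℕ) • a + (2 : ℕ) • b) (-((2 : ℕ) • a) - b) [((1, 1), -ε₅), ((1, 2), -ε₂ * ε₅), ((1, 3), ε₂ * ε₃ * ε₅), ((2, 3), 2 * ε₁ * ε₂)] ∧
  ConstantsAre C (-((2 : ℕ) • a) - b) ((3 : ℕ) • a + (2 : ℕ) • b) [((1, 1), ε₅), ((2, 1), -ε₂ * ε₅), ((3, 1), -ε₂ * ε₃ * ε₅), ((3, 2), -ε₁ * ε₂)] ∧
  ConstantsAre C ((3 : ℕ) • a + (2 : ℕ) • b) (-((3 : ℕ) • a) - b) [((1, 1), ε₄)] ∧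
  ConstantsAre C (-((3 : ℕ) • a) - (2 : ℕ) • b) b [((1, 1), ε₄)] ∧
  ConstantsAre C (-((3 : ℕ) • a) - (2 : ℕ) • b) ((3 : ℕ) • a + b) [((1, 1), -ε₄)] ∧
  ConstantsAre C (-((3 : ℕ) • a) - b) (-b) [((1, 1), ε₄)] ∧
  ConstantsAre C (-((3 : ℕ) • a) - b) ((3 : ℕ) • a + (2 : ℕ) • b) [((1, 1), -ε₄)] ∧
  ConstantsAre C (-((2 : ℕ) • a) - b) (-a - b) [((1, 1), -3 * ε₅)] ∧
  ConstantsAre C (-((2 : ℕ) • a) - b) (-a) [((1, 1), 3 * ε₃)] ∧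
  ConstantsAre C (-((2 : ℕ) • a) - b) a [((1, 1), 2 * ε₂), ((2, 1), -3 * ε₂ * ε₅), ((1, 2), 3 * ε₁ * ε₂)] ∧
  ConstantsAre C (-((2 : ℕ) • a) - b) (a + b) [((1, 1), -2 * ε₂), ((2, 1), -3 * ε₂ * ε₃), ((1, 2), -3 * ε₁ * ε₂)] ∧
  ConstantsAre C (-a - b) (-a) [((1, 1), 2 * ε₂), ((2, 1), 3 * ε₂ * ε₅), ((1, 2), 3 * ε₂ * ε₃)] ∧
  ConstantsAre C (-a - b) a [((1, 1), 3 * ε₁)] ∧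
  ConstantsAre C (-a - b) ((2 : ℕ) • a + b) [((1, 1), -2 * ε₂), ((2, 1), -3 * ε₁ * ε₂), ((1, 2), -3 * ε₂ * ε₃)] ∧
  ConstantsAre C (-a) (a + b) [((1, 1), 3 * ε₁)] ∧
  ConstantsAre C (-a) ((2 : ℕ) • a + b) [((1, 1), 2 * ε₂), ((2, 1), 3 * ε₁ * ε₂), ((1, 2), -3 * ε₂ * ε₅)] ∧
  ConstantsAre C (-b) ((3 : ℕ) • a + (2 : ℕ) • b) [((1, 1), ε₄)] ∧
  ConstantsAre C (a + b) a [((1, 1), -2 * ε₂), ((2, 1), 3 * ε₂ * ε₅), ((1, 2), 3 * ε₂ * ε₃)] ∧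
  ConstantsAre C ((2 : ℕ) • a + b) a [((1, 1), -3 * ε₃)] ∧
  ConstantsAre C ((2 : ℕ) • a + b) (a + b) [((1, 1), 3 * ε₅)] ∧
  ConstantsAre C ((3 : ℕ) • a + b) b [((1, 1), -ε₄)] ∧
  ConstantsAre C ((3 : ℕ) • a + (2 : ℕ) • b) (-b) [((1, 1), -ε₄)]

/-- The commutator formulas for two positive roots. -/
def PositiveFormulas {V K G : Type*} [AddCommGroup V] [CommRing K] [Group G] (x : V → K → G)
    (a b : V) (ε₁ ε₂ ε₃ ε₄ ε₅ : K) (t u : K) : Prop :=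
  comm (x b u) (x a t) =
      x (a + b) (-ε₁ * t * u) * x ((2 : ℕ) • a + b) (ε₁ * ε₂ * t ^ 2 * u) *
        x ((3 : ℕ) • a + b) (-ε₁ * ε₂ * ε₃ * t ^ 3 * u) * x ((3 : ℕ) • a + (2 : ℕ) • b) (-ε₂ * ε₅ * t ^ 3 * u ^ 2) ∧
  comm (x a u) (x b t) =
      x (a + b) (ε₁ * t * u) * x ((2 : ℕ) • a + b) (-ε₁ * ε₂ * t * u ^ 2) *
        x ((3 : ℕ) • a + b) (ε₁ * ε₂ * ε₃ * t * u ^ 3) *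
        x ((3 : ℕ) • a + (2 : ℕ) • b) (-2 * ε₂ * ε₅ * t ^ 2 * u ^ 3) ∧
  comm (x (a + b) u) (x a t) =
      x ((2 : ℕ) • a + b) (-2 * ε₂ * t * u) * x ((3 : ℕ) • a + b) (3 * ε₂ * ε₃ * t ^ 2 * u) *
        x ((3 : ℕ) • a + (2 : ℕ) • b) (-3 * ε₂ * ε₅ * t * u ^ 2) ∧
  comm (x ((2 : ℕ) • a + b) u) (x a t) = x ((3 : ℕ) • a + b) (-3 * ε₃ * t * u) ∧
  comm (x ((3 : ℕ) • a + b) u) (x b t) = x ((3 : ℕ) • a + (2 : ℕ) • b) (-ε₄ * t * u) ∧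
  comm (x ((2 : ℕ) • a + b) u) (x (a + b) t) = x ((3 : ℕ) • a + (2 : ℕ) • b) (3 * ε₅ * t * u)

/-- The commutator formulas for two negative roots. -/
def NegativeFormulas {V K G : Type*} [AddCommGroup V] [CommRing K] [Group G] (x : V → K → G)
    (a b : V) (ε₁ ε₂ ε₃ ε₄ ε₅ : K) (t u : K) : Prop :=
  comm (x (-b) u) (x (-a) t) =
      x (-a - b) (ε₁ * t * u) * x (-((2 : ℕ) • a) - b) (ε₁ * ε₂ * t ^ 2 * u) *
        x (-((3 : ℕ) • a) - b) (ε₁ * ε₂ * ε₃ * t ^ 3 * u) *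
        x (-((3 : ℕ) • a) - (2 : ℕ) • b) (-ε₂ * ε₅ * t ^ 3 * u ^ 2) ∧
  comm (x (-a) u) (x (-b) t) =
      x (-a - b) (-ε₁ * t * u) * x (-((2 : ℕ) • a) - b) (-ε₁ * ε₂ * t * u ^ 2) *
        x (-((3 : ℕ) • a) - b) (-ε₁ * ε₂ * ε₃ * t * u ^ 3) *
        x (-((3 : ℕ) • a) - (2 : ℕ) • b) (-2 * ε₂ * ε₅ * t ^ 2 * u ^ 3) ∧
  comm (x (-a - b) u) (x (-a) t) =
      x (-((2 : ℕ) • a) - b) (2 * ε₂ * t * u) * x (-((3 : ℕ) • a) - b) (3 * ε₂ * ε₃ * t ^ 2 * u) *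
        x (-((3 : ℕ) • a) - (2 : ℕ) • b) (-3 * ε₂ * ε₅ * t * u ^ 2) ∧
  comm (x (-((2 : ℕ) • a) - b) u) (x (-a) t) = x (-((3 : ℕ) • a) - b) (3 * ε₃ * t * u) ∧
  comm (x (-((3 : ℕ) • a) - b) u) (x (-b) t) = x (-((3 : ℕ) • a) - (2 : ℕ) • b) (ε₄ * t * u) ∧
  comm (x (-((2 : ℕ) • a) - b) u) (x (-a - b) t) = x (-((3 : ℕ) • a) - (2 : ℕ) • b) (-3 * ε₅ * t * u)

/-- Commutator formulas for a positive and a negative root, first part. -/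
def MixedFormulasI {V K G : Type*} [AddCommGroup V] [CommRing K] [Group G] (x : V → K → G)
    (a b : V) (ε₁ ε₂ ε₃ ε₄ ε₅ : K) (t u : K) : Prop :=
  comm (x (-a - b) u) (x a t) = x (-b) (3 * ε₁ * t * u) ∧
  comm (x (-((2 : ℕ) • a) - b) u) (x a t) =
      x (-a - b) (2 * ε₂ * t * u) * x (-b) (3 * ε₁ * ε₂ * t ^ 2 * u) *
        x (-((3 : ℕ) • a) - (2 : ℕ) • b) (3 * ε₂ * ε₅ * t * u ^ 2) ∧
  comm (x (-((3 : ℕ) • a) - b) u) (x a t) =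
      x (-((2 : ℕ) • a) - b) (ε₃ * t * u) * x (-a - b) (ε₂ * ε₃ * t ^ 2 * u) *
        x (-b) (ε₁ * ε₂ * ε₃ * t ^ 3 * u) * x (-((3 : ℕ) • a) - (2 : ℕ) • b) (ε₂ * ε₅ * t ^ 3 * u ^ 2) ∧
  comm (x a u) (x (-((3 : ℕ) • a) - b) t) =
      x (-((2 : ℕ) • a) - b) (-ε₃ * t * u) * x (-a - b) (-ε₂ * ε₃ * t * u ^ 2) *
        x (-b) (-ε₁ * ε₂ * ε₃ * t * u ^ 3) * x (-((3 : ℕ) • a) - (2 : ℕ) • b) (2 * ε₂ * ε₅ * t ^ 2 * u ^ 3) ∧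
  comm (x b u) (x (-a - b) t) =
      x (-a) (ε₁ * t * u) * x (-((2 : ℕ) • a) - b) (-ε₁ * ε₂ * t ^ 2 * u) *
        x (-((3 : ℕ) • a) - (2 : ℕ) • b) (ε₁ * ε₂ * ε₅ * t ^ 3 * u) *
        x (-((3 : ℕ) • a) - b) (-ε₂ * ε₃ * t ^ 3 * u ^ 2) ∧
  comm (x (-a - b) u) (x b t) =
      x (-a) (-ε₁ * t * u) * x (-((2 : ℕ) • a) - b) (ε₁ * ε₂ * t * u ^ 2) *
        x (-((3 : ℕ) • a) - (2 : ℕ) • b) (-ε₁ * ε₂ * ε₅ * t * u ^ 3) *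
        x (-((3 : ℕ) • a) - b) (-2 * ε₂ * ε₃ * t ^ 2 * u ^ 3) ∧
  comm (x (-((3 : ℕ) • a) - (2 : ℕ) • b) u) (x b t) = x (-((3 : ℕ) • a) - b) (ε₄ * t * u) ∧
  comm (x (-a) u) (x (a + b) t) = x b (3 * ε₁ * t * u) ∧
  comm (x (-b) u) (x (a + b) t) =
      x a (-ε₁ * t * u) * x ((2 : ℕ) • a + b) (-ε₁ * ε₂ * t ^ 2 * u) *
        x ((3 : ℕ) • a + (2 : ℕ) • b) (-ε₁ * ε₂ * ε₅ * t ^ 3 * u) * x ((3 : ℕ) • a + b) (-ε₂ * ε₃ * t ^ 3 * u ^ 2) ∧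
  comm (x (a + b) u) (x (-b) t) =
      x a (ε₁ * t * u) * x ((2 : ℕ) • a + b) (ε₁ * ε₂ * t * u ^ 2) *
        x ((3 : ℕ) • a + (2 : ℕ) • b) (ε₁ * ε₂ * ε₅ * t * u ^ 3) *
        x ((3 : ℕ) • a + b) (-2 * ε₂ * ε₃ * t ^ 2 * u ^ 3)

/-- Commutator formulas for a positive and a negative root, second part. -/
def MixedFormulasII {V K G : Type*} [AddCommGroup V] [CommRing K] [Group G] (x : V → K → G)
    (a b : V) (ε₁ ε₂ ε₃ ε₄ ε₅ : K) (t u : K) : Prop :=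
  comm (x (-((2 : ℕ) • a) - b) u) (x (a + b) t) =
      x (-a) (-2 * ε₂ * t * u) * x b (-3 * ε₁ * ε₂ * t ^ 2 * u) *
        x (-((3 : ℕ) • a) - b) (3 * ε₂ * ε₃ * t * u ^ 2) ∧
  comm (x (-((3 : ℕ) • a) - (2 : ℕ) • b) u) (x (a + b) t) =
      x (-((2 : ℕ) • a) - b) (-ε₅ * t * u) * x (-a) (ε₂ * ε₅ * t ^ 2 * u) *
        x b (ε₁ * ε₂ * ε₅ * t ^ 3 * u) * x (-((3 : ℕ) • a) - b) (ε₂ * ε₃ * t ^ 3 * u ^ 2) ∧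
  comm (x (a + b) u) (x (-((3 : ℕ) • a) - (2 : ℕ) • b) t) =
      x (-((2 : ℕ) • a) - b) (ε₅ * t * u) * x (-a) (-ε₂ * ε₅ * t * u ^ 2) *
        x b (-ε₁ * ε₂ * ε₅ * t * u ^ 3) * x (-((3 : ℕ) • a) - b) (2 * ε₂ * ε₃ * t ^ 2 * u ^ 3) ∧
  comm (x (-a) u) (x ((2 : ℕ) • a + b) t) =
      x (a + b) (2 * ε₂ * t * u) * x ((3 : ℕ) • a + (2 : ℕ) • b) (-3 * ε₂ * ε₅ * t ^ 2 * u) *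
        x b (-3 * ε₁ * ε₂ * t * u ^ 2) ∧
  comm (x (-a - b) u) (x ((2 : ℕ) • a + b) t) =
      x a (-2 * ε₂ * t * u) * x ((3 : ℕ) • a + b) (-3 * ε₂ * ε₃ * t ^ 2 * u) *
        x (-b) (3 * ε₁ * ε₂ * t * u ^ 2) ∧
  comm (x (-((3 : ℕ) • a) - b) u) (x ((2 : ℕ) • a + b) t) =
      x (-a) (-ε₃ * t * u) * x (a + b) (-ε₂ * ε₃ * t ^ 2 * u) *
        x ((3 : ℕ) • a + (2 : ℕ) • b) (ε₂ * ε₃ * ε₅ * t ^ 3 * u) * x b (-ε₁ * ε₂ * t ^ 3 * u ^ 2) ∧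
  comm (x ((2 : ℕ) • a + b) u) (x (-((3 : ℕ) • a) - b) t) =
      x (-a) (ε₃ * t * u) * x (a + b) (ε₂ * ε₃ * t * u ^ 2) *
        x ((3 : ℕ) • a + (2 : ℕ) • b) (-ε₂ * ε₃ * ε₅ * t * u ^ 3) * x b (-2 * ε₁ * ε₂ * t ^ 2 * u ^ 3) ∧
  comm (x (-((3 : ℕ) • a) - (2 : ℕ) • b) u) (x ((2 : ℕ) • a + b) t) =
      x (-a - b) (ε₅ * t * u) * x a (-ε₂ * ε₅ * t ^ 2 * u) *
        x ((3 : ℕ) • a + b) (-ε₂ * ε₃ * ε₅ * t ^ 3 * u) * x (-b) (ε₁ * ε₂ * t ^ 3 * u ^ 2) ∧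
  comm (x ((2 : ℕ) • a + b) u) (x (-((3 : ℕ) • a) - (2 : ℕ) • b) t) =
      x (-a - b) (-ε₅ * t * u) * x a (ε₂ * ε₅ * t * u ^ 2) *
        x ((3 : ℕ) • a + b) (ε₂ * ε₃ * ε₅ * t * u ^ 3) * x (-b) (2 * ε₁ * ε₂ * t ^ 2 * u ^ 3)

/-- Commutator formulas for a positive and a negative root, third part. -/
def MixedFormulasIII {V K G : Type*} [AddCommGroup V] [CommRing K] [Group G] (x : V → K → G)
    (a b : V) (ε₁ ε₂ ε₃ ε₄ ε₅ : K) (t u : K) : Prop :=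
  comm (x (-a) u) (x ((3 : ℕ) • a + b) t) =
      x ((2 : ℕ) • a + b) (ε₃ * t * u) * x (a + b) (-ε₂ * ε₃ * t * u ^ 2) *
        x b (ε₁ * ε₂ * ε₃ * t * u ^ 3) * x ((3 : ℕ) • a + (2 : ℕ) • b) (2 * ε₂ * ε₅ * t ^ 2 * u ^ 3) ∧
  comm (x ((3 : ℕ) • a + b) u) (x (-a) t) =
      x ((2 : ℕ) • a + b) (-ε₃ * t * u) * x (a + b) (ε₂ * ε₃ * t ^ 2 * u) *
        x b (-ε₁ * ε₂ * ε₃ * t ^ 3 * u) * x ((3 : ℕ) • a + (2 : ℕ) • b) (ε₂ * ε₅ * t ^ 3 * u ^ 2) ∧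
  comm (x (-((2 : ℕ) • a) - b) u) (x ((3 : ℕ) • a + b) t) =
      x a (-ε₃ * t * u) * x (-a - b) (ε₂ * ε₃ * t * u ^ 2) *
        x (-((3 : ℕ) • a) - (2 : ℕ) • b) (ε₂ * ε₃ * ε₅ * t * u ^ 3) * x (-b) (-2 * ε₁ * ε₂ * t ^ 2 * u ^ 3) ∧
  comm (x ((3 : ℕ) • a + b) u) (x (-((2 : ℕ) • a) - b) t) =
      x a (ε₃ * t * u) * x (-a - b) (-ε₂ * ε₃ * t ^ 2 * u) *
        x (-((3 : ℕ) • a) - (2 : ℕ) • b) (-ε₂ * ε₃ * ε₅ * t ^ 3 * u) * x (-b) (-ε₁ * ε₂ * t ^ 3 * u ^ 2) ∧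
  comm (x (-((3 : ℕ) • a) - (2 : ℕ) • b) u) (x ((3 : ℕ) • a + b) t) = x (-b) (-ε₄ * t * u) ∧
  comm (x (-a - b) u) (x ((3 : ℕ) • a + (2 : ℕ) • b) t) =
      x ((2 : ℕ) • a + b) (-ε₅ * t * u) * x a (-ε₂ * ε₅ * t * u ^ 2) * x (-b) (ε₁ * ε₂ * ε₅ * t * u ^ 3) *
        x ((3 : ℕ) • a + b) (2 * ε₂ * ε₃ * t ^ 2 * u ^ 3) ∧
  comm (x ((3 : ℕ) • a + (2 : ℕ) • b) u) (x (-a - b) t) =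
      x ((2 : ℕ) • a + b) (ε₅ * t * u) * x a (ε₂ * ε₅ * t ^ 2 * u) * x (-b) (-ε₁ * ε₂ * ε₅ * t ^ 3 * u) *
        x ((3 : ℕ) • a + b) (ε₂ * ε₃ * t ^ 3 * u ^ 2) ∧
  comm (x (-((2 : ℕ) • a) - b) u) (x ((3 : ℕ) • a + (2 : ℕ) • b) t) =
      x (a + b) (ε₅ * t * u) * x (-a) (ε₂ * ε₅ * t * u ^ 2) *
        x (-((3 : ℕ) • a) - b) (-ε₂ * ε₃ * ε₅ * t * u ^ 3) * x b (2 * ε₁ * ε₂ * t ^ 2 * u ^ 3) ∧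
  comm (x ((3 : ℕ) • a + (2 : ℕ) • b) u) (x (-((2 : ℕ) • a) - b) t) =
      x (a + b) (-ε₅ * t * u) * x (-a) (-ε₂ * ε₅ * t ^ 2 * u) *
        x (-((3 : ℕ) • a) - b) (ε₂ * ε₃ * ε₅ * t ^ 3 * u) * x b (ε₁ * ε₂ * t ^ 3 * u ^ 2) ∧
  comm (x (-((3 : ℕ) • a) - b) u) (x ((3 : ℕ) • a + (2 : ℕ) • b) t) = x b (-ε₄ * t * u)

/-- The commutator formulas for the remaining ordered pairs of roots whose sum is a root. (Apart
from the two orders of the pair `-b`, `3a + 2b`, these pairs occur above in the other order.) -/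
def RemainingFormulas {V K G : Type*} [AddCommGroup V] [CommRing K] [Group G] (x : V → K → G)
    (a b : V) (ε₁ ε₂ ε₃ ε₄ ε₅ : K) (t u : K) : Prop :=
  comm (x b u) (x (-((3 : ℕ) • a) - (2 : ℕ) • b) t) = x (-((3 : ℕ) • a) - b) (-ε₄ * t * u) ∧
  comm (x ((3 : ℕ) • a + b) u) (x (-((3 : ℕ) • a) - (2 : ℕ) • b) t) = x (-b) (ε₄ * t * u) ∧
  comm (x (-b) u) (x (-((3 : ℕ) • a) - b) t) = x (-((3 : ℕ) • a) - (2 : ℕ) • b) (-ε₄ * t * u) ∧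
  comm (x ((3 : ℕ) • a + (2 : ℕ) • b) u) (x (-((3 : ℕ) • a) - b) t) = x b (ε₄ * t * u) ∧
  comm (x (-a - b) u) (x (-((2 : ℕ) • a) - b) t) = x (-((3 : ℕ) • a) - (2 : ℕ) • b) (3 * ε₅ * t * u) ∧
  comm (x (-a) u) (x (-((2 : ℕ) • a) - b) t) = x (-((3 : ℕ) • a) - b) (-3 * ε₃ * t * u) ∧
  comm (x a u) (x (-((2 : ℕ) • a) - b) t) =
      x (-a - b) (-2 * ε₂ * t * u) * x (-((3 : ℕ) • a) - (2 : ℕ) • b) (-3 * ε₂ * ε₅ * t ^ 2 * u) *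
        x (-b) (-3 * ε₁ * ε₂ * t * u ^ 2) ∧
  comm (x (a + b) u) (x (-((2 : ℕ) • a) - b) t) =
      x (-a) (2 * ε₂ * t * u) * x (-((3 : ℕ) • a) - b) (-3 * ε₂ * ε₃ * t ^ 2 * u) *
        x b (3 * ε₁ * ε₂ * t * u ^ 2) ∧
  comm (x (-a) u) (x (-a - b) t) =
      x (-((2 : ℕ) • a) - b) (-2 * ε₂ * t * u) * x (-((3 : ℕ) • a) - (2 : ℕ) • b) (3 * ε₂ * ε₅ * t ^ 2 * u) *
        x (-((3 : ℕ) • a) - b) (-3 * ε₂ * ε₃ * t * u ^ 2) ∧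
  comm (x a u) (x (-a - b) t) = x (-b) (-3 * ε₁ * t * u) ∧
  comm (x ((2 : ℕ) • a + b) u) (x (-a - b) t) =
      x a (2 * ε₂ * t * u) * x (-b) (-3 * ε₁ * ε₂ * t ^ 2 * u) *
        x ((3 : ℕ) • a + b) (3 * ε₂ * ε₃ * t * u ^ 2) ∧
  comm (x (a + b) u) (x (-a) t) = x b (-3 * ε₁ * t * u) ∧
  comm (x ((2 : ℕ) • a + b) u) (x (-a) t) =
      x (a + b) (-2 * ε₂ * t * u) * x b (3 * ε₁ * ε₂ * t ^ 2 * u) *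
        x ((3 : ℕ) • a + (2 : ℕ) • b) (3 * ε₂ * ε₅ * t * u ^ 2) ∧
  comm (x ((3 : ℕ) • a + (2 : ℕ) • b) u) (x (-b) t) = x ((3 : ℕ) • a + b) (-ε₄ * t * u) ∧
  comm (x a u) (x (a + b) t) =
      x ((2 : ℕ) • a + b) (2 * ε₂ * t * u) * x ((3 : ℕ) • a + (2 : ℕ) • b) (3 * ε₂ * ε₅ * t ^ 2 * u) *
        x ((3 : ℕ) • a + b) (-3 * ε₂ * ε₃ * t * u ^ 2) ∧
  comm (x a u) (x ((2 : ℕ) • a + b) t) = x ((3 : ℕ) • a + b) (3 * ε₃ * t * u) ∧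
  comm (x (a + b) u) (x ((2 : ℕ) • a + b) t) = x ((3 : ℕ) • a + (2 : ℕ) • b) (-3 * ε₅ * t * u) ∧
  comm (x b u) (x ((3 : ℕ) • a + b) t) = x ((3 : ℕ) • a + (2 : ℕ) • b) (ε₄ * t * u) ∧
  comm (x (-b) u) (x ((3 : ℕ) • a + (2 : ℕ) • b) t) = x ((3 : ℕ) • a + b) (ε₄ * t * u)

/-- The commutator formulas in type `G₂` (`a` short, `b` long) for all ordered pairs of roots whose
sum is a root. -/
def CommutatorFormulas {V K G : Type*} [AddCommGroup V] [CommRing K] [Group G] (x : V → K → G)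
    (a b : V) (ε₁ ε₂ ε₃ ε₄ ε₅ : K) (t u : K) : Prop :=
  PositiveFormulas x a b ε₁ ε₂ ε₃ ε₄ ε₅ t u ∧
  NegativeFormulas x a b ε₁ ε₂ ε₃ ε₄ ε₅ t u ∧
  MixedFormulasI x a b ε₁ ε₂ ε₃ ε₄ ε₅ t u ∧
  MixedFormulasII x a b ε₁ ε₂ ε₃ ε₄ ε₅ t u ∧
  MixedFormulasIII x a b ε₁ ε₂ ε₃ ε₄ ε₅ t u ∧
  RemainingFormulas x a b ε₁ ε₂ ε₃ ε₄ ε₅ t u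

end G2

/-!
Over a field of characteristic zero `x_r(t)` is the exponential of the nilpotent operator
`t ad(e_r)`, so `x_r(t)⁻¹ x_s(u) x_r(t)` is the exponential of the image of `u ad(e_s)` under
`exp(-t ad(e_r))`, a sum of operators `ad(e_{ir+s})`. The roots among the `ir + js` are so few that
the Baker–Campbell–Hausdorff formula for a central commutator splits it into the required product.
The formula is an identity of matrices with entries in `ℤ[t, u]`, so it may be checked over the
field of fractions and then specialised to any commutative ring. As `L_ℤ` is flat over `ℤ`, nothing
is lost on the way.

Up to sign `N_{r,s}` is read off the root strings. The invariance of the Killing form shows that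
`N_{r,s}`, `N_{s,w}` and `N_{w,r}` have the same sign if `r + s + w = 0`, and this, together with
`N_{s,r} = -N_{r,s} = N_{-r,-s}`, reduces every structure constant to those of the five pairs of
positive roots. Four of them define `ε₁, …, ε₄`, and the Jacobi identity for `a`, `b` and `2a + b`
gives the fifth one.
-/

namespace G2

/-! ### Exponentials of nilpotent elements -/

section Exp

open Polynomial
open IsNilpotent hiding pow_succ

attribute [local instance] LieRing.ofAssociativeRing

lemma isNilpotent_of_semiconjBy {M : Type*} [MonoidWithZero M] {g x y : M} (hg : IsUnit g)
    (h : SemiconjBy g x y) (hy : IsNilpotent y) : IsNilpotent x := by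
  obtain ⟨n, hn⟩ := hy
  refine ⟨n, hg.mul_right_eq_zero.1 ?_⟩
  rw [(h.pow_right n).eq, hn, zero_mul]

lemma isNilpotent_C_mul_X_pow {S : Type*} [Semiring S] {x : S} (hx : IsNilpotent x) (n : ℕ) :
    IsNilpotent (C x * X ^ n) :=
  (commute_X_pow _ n).symm.isNilpotent_mul_right (hx.map C)

variable {R : Type*} [Ring R] [Algebra ℚ R]

lemma commute_exp_right {x y : R} (h : Commute x y) : Commute x (exp y) :=
  Commute.sum_right _ _ _ fun _ _ => (h.pow_right _).smul_right _

lemma commute_exp_exp {x y : R} (h : Commute x y) : Commute (exp x) (exp y) :=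
  commute_exp_right (commute_exp_right h.symm).symm

lemma exp_mulRight_apply {x : R} (hx : IsNilpotent x) (y : R) :
    exp (LinearMap.mulRight ℚ x) y = y * exp x := by
  obtain ⟨k, hk⟩ := hx
  rw [exp_eq_sum (k := k) (by rw [LinearMap.pow_mulRight, hk, LinearMap.mulRight_zero_eq_zero]),
    exp_eq_sum hk, Finset.mul_sum, LinearMap.sum_apply]
  exact Finset.sum_congr rfl fun n _ => by
    rw [LinearMap.smul_apply, LinearMap.pow_mulRight, LinearMap.mulRight_apply, mul_smul_comm]

lemma exp_mul_eq_exp_ad_mul {x : R} (hx : IsNilpotent x) (y : R) :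
    exp x * y = exp (LieAlgebra.ad ℚ R x) y * exp x := by
  have had : LinearMap.mulLeft ℚ x = LinearMap.mulRight ℚ x + LieAlgebra.ad ℚ R x := by
    ext v; simp [Ring.lie_def]
  have hcomm : Commute (LinearMap.mulRight ℚ x) (LieAlgebra.ad ℚ R x) := by
    rw [show LieAlgebra.ad ℚ R x = LinearMap.mulLeft ℚ x - LinearMap.mulRight ℚ x by
      rw [had, add_sub_cancel_left]]
    exact (LinearMap.commute_mulLeft_right ..).symm.sub_right (Commute.refl _)
  have hright := (LinearMap.isNilpotent_mulRight_iff ℚ x).2 hx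
  calc exp x * y = exp (LinearMap.mulLeft ℚ x) y :=
        LinearMap.congr_fun (map_exp hx (Algebra.lmul ℚ R)) y
    _ = exp (LieAlgebra.ad ℚ R x) y * exp x := by
        rw [had, exp_add_of_commute hcomm hright (LieAlgebra.ad_nilpotent_of_nilpotent hx),
          Module.End.mul_apply, exp_mulRight_apply hx]

lemma exp_mul_of_lie {x y f₁ f₂ f₃ : R} (hx : IsNilpotent x) (h₁ : ⁅x, y⁆ = f₁)
    (h₂ : ⁅x, f₁⁆ = (2 : ℚ) • f₂) (h₃ : ⁅x, f₂⁆ = (3 : ℚ) • f₃) (h₄ : ⁅x, f₃⁆ = 0) :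
    exp x * y = (y + f₁ + f₂ + f₃) * exp x := by
  have hpow : (LieAlgebra.ad ℚ R x ^ 4) • y = 0 := by
    simp only [pow_succ', pow_zero, mul_one, Module.End.smul_def, Module.End.mul_apply,
      LieAlgebra.ad_apply, h₁, h₂, h₃, h₄, lie_smul, smul_zero]
  have hexp := exp_smul_eq_sum hpow (LieAlgebra.ad_nilpotent_of_nilpotent hx)
  rw [exp_mul_eq_exp_ad_mul hx, ← Module.End.smul_def, hexp]
  congr 1
  simp only [Finset.sum_range_succ, Finset.sum_range_zero, pow_succ', pow_zero, mul_one,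
    Module.End.smul_def, Module.End.mul_apply, Module.End.one_apply, LieAlgebra.ad_apply, h₁, h₂,
    h₃, lie_smul, smul_smul, Nat.factorial]
  norm_num

lemma semiconjBy_exp {g x y : R} (h : SemiconjBy g x y) (hx : IsNilpotent x)
    (hy : IsNilpotent y) : SemiconjBy g (exp x) (exp y) := by
  obtain ⟨m, hm⟩ := hx
  obtain ⟨n, hn⟩ := hy
  rw [SemiconjBy, exp_eq_sum (pow_eq_zero_of_le (le_max_left m n) hm),
    exp_eq_sum (pow_eq_zero_of_le (le_max_right m n) hn), Finset.mul_sum, Finset.sum_mul]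
  exact Finset.sum_congr rfl fun k _ => by
    rw [mul_smul_comm, smul_mul_assoc, (h.pow_right k).eq]

lemma exp_mul_exp_of_lie {x y f₁ f₂ f₃ : R} (hx : IsNilpotent x) (hy : IsNilpotent y)
    (h₁ : ⁅x, y⁆ = f₁) (h₂ : ⁅x, f₁⁆ = (2 : ℚ) • f₂) (h₃ : ⁅x, f₂⁆ = (3 : ℚ) • f₃)
    (h₄ : ⁅x, f₃⁆ = 0) : exp y * exp x = exp x * exp (y - f₁ + f₂ - f₃) := by
  have hneg : exp (-x) * y = (y - f₁ + f₂ - f₃) * exp (-x) := by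
    rw [exp_mul_of_lie (f₁ := -f₁) (f₂ := f₂) (f₃ := -f₃) (y := y) hx.neg (by simp [h₁])
      (by simp [h₂]) (by simp [h₃]) (by simp [h₄])]
    abel_nf
  have hsemi : SemiconjBy (exp x) (y - f₁ + f₂ - f₃) y := by
    calc exp x * (y - f₁ + f₂ - f₃)
        = exp x * ((y - f₁ + f₂ - f₃) * exp (-x)) * exp x := by
          simp only [mul_assoc, exp_neg_mul_exp_self hx, mul_one]
      _ = y * exp x := by
          rw [← hneg, ← mul_assoc, exp_mul_exp_neg_self hx, one_mul]
  exact (semiconjBy_exp hsemi (isNilpotent_of_semiconjBy (isUnit_exp hx) hsemi hy) hy).eq.symm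

lemma derivative_pow_of_commute {p : R[X]} (h : Commute p (derivative p)) (n : ℕ) :
    derivative (p ^ (n + 1)) = ((n + 1 : ℕ) : ℚ) • (derivative p * p ^ n) := by
  induction n with
  | zero => simp
  | succ n ih =>
    rw [pow_succ p (n + 1), derivative_mul, ih, smul_mul_assoc, mul_assoc, ← pow_succ,
      (h.pow_left (n + 1)).eq, Nat.cast_succ (n + 1), add_smul, one_smul]

lemma derivative_exp {p : R[X]} (hp : IsNilpotent p) (h : Commute p (derivative p)) :
    derivative (exp p) = derivative p * exp p := by
  obtain ⟨n, hn⟩ := hp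
  conv_lhs => rw [exp_eq_sum (pow_eq_zero_of_le n.le_succ hn)]
  rw [exp_eq_sum hn, derivative_sum, Finset.sum_range_succ', pow_zero, derivative_smul,
    derivative_one, smul_zero, add_zero, Finset.mul_sum]
  refine Finset.sum_congr rfl fun k _ => ?_
  rw [derivative_smul, derivative_pow_of_commute h, smul_smul, mul_smul_comm, Nat.factorial_succ,
    Nat.cast_mul, mul_inv_rev, mul_assoc, inv_mul_cancel₀ (by positivity), mul_one]

lemma coeff_of_derivative_eq_C_mul {T : R} {G : R[X]} (h₀ : G.coeff 0 = 1)
    (h : derivative G = C T * G) (n : ℕ) : G.coeff n = (n.factorial : ℚ)⁻¹ • T ^ n := by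
  induction n with
  | zero => simp [h₀]
  | succ n ih =>
    have hcoeff : ((n + 1 : ℕ) : ℚ) • G.coeff (n + 1) = (n.factorial : ℚ)⁻¹ • T ^ (n + 1) := by
      have := congrArg (fun p => coeff p n) h
      simp only [coeff_derivative, coeff_C_mul, ih] at this
      rw [Nat.cast_smul_eq_nsmul, nsmul_eq_mul', Nat.cast_succ, this, mul_smul_comm, pow_succ']
    rw [Nat.factorial_succ, Nat.cast_mul, mul_inv, mul_smul, ← hcoeff, smul_smul,
      inv_mul_cancel₀ (by positivity), one_smul]

lemma exp_eq_eval_one_of_derivative {T : R} {G : R[X]} (h₀ : G.coeff 0 = 1)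
    (h : derivative G = C T * G) : IsNilpotent T ∧ exp T = G.eval 1 := by
  have hcoeff := coeff_of_derivative_eq_C_mul h₀ h
  have hT : T ^ (G.natDegree + 1) = 0 := by
    have hzero := hcoeff (G.natDegree + 1)
    rw [coeff_eq_zero_of_natDegree_lt (Nat.lt_succ_self _)] at hzero
    exact (smul_eq_zero.1 hzero.symm).resolve_left (by positivity)
  exact ⟨⟨_, hT⟩, by simp [exp_eq_sum hT, eval_eq_sum_range, hcoeff]⟩

lemma commute_C_mul_X_pow {S : Type*} [Semiring S] {x y : S} (h : Commute x y) (m n : ℕ) :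
    Commute (C x * X ^ m) (C y * X ^ n) :=
  ((h.map C).mul_left (commute_X_pow _ m)).mul_right
    ((commute_X_pow _ n).symm.mul_left (Commute.pow_pow (Commute.refl X) m n))

lemma derivative_exp_C_mul_X_pow {x : R} (hx : IsNilpotent x) (n : ℕ) :
    derivative (exp (C x * X ^ n)) = C (x * n) * X ^ (n - 1) * exp (C x * X ^ n) := by
  rw [derivative_exp (isNilpotent_C_mul_X_pow hx n), derivative_C_mul_X_pow]
  rw [derivative_C_mul_X_pow]
  exact commute_C_mul_X_pow ((Commute.refl x).mul_right (Nat.commute_cast x n)) _ _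

lemma coeff_zero_exp_C_mul_X_pow {x : R} (hx : IsNilpotent x) {n : ℕ} (hn : n ≠ 0) :
    (exp (C x * X ^ n)).coeff 0 = 1 := by
  have h := map_exp (isNilpotent_C_mul_X_pow hx n) (constantCoeff (R := R))
  rwa [map_mul, map_pow, constantCoeff_apply X, coeff_X_zero, zero_pow hn, mul_zero, exp_zero] at h

lemma eval_one_mul {S : Type*} [Semiring S] (p q : S[X]) :
    (p * q).eval 1 = p.eval 1 * q.eval 1 :=
  map_mul (eval₂RingHom' (RingHom.id S) 1 fun _ => Commute.one_right _) p q

lemma eval_one_exp_C_mul_X_pow {x : R} (hx : IsNilpotent x) (n : ℕ) :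
    (exp (C x * X ^ n)).eval 1 = exp x := by
  have h := map_exp (isNilpotent_C_mul_X_pow hx n)
    (eval₂RingHom' (RingHom.id R) 1 fun _ => Commute.one_right _)
  simpa using h

lemma exp_C_mul_X_mul_C {x y z : R} (hx : IsNilpotent x) (h : ⁅x, y⁆ = (2 : ℚ) • z)
    (hxz : Commute x z) :
    exp (C x * X ^ 1) * C y = (C y + 2 * (C z * X ^ 1)) * exp (C x * X ^ 1) := by
  have hlie : ⁅C x * X ^ 1, C y⁆ = 2 * (C z * X ^ 1) := by
    calc ⁅C x * X ^ 1, C y⁆ = C ⁅x, y⁆ * X := by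
          rw [pow_one, Ring.lie_def, Ring.lie_def, mul_assoc, X_mul_C, C_sub, C_mul, C_mul]
          noncomm_ring
      _ = 2 * (C z * X ^ 1) := by
          rw [h, ofNat_smul_eq_nsmul, two_nsmul, C_add, pow_one, two_mul, add_mul]
  have hcomm : ⁅C x * X ^ 1, 2 * (C z * X ^ 1)⁆ = 0 :=
    sub_eq_zero.2 ((Commute.ofNat_right _ 2).mul_right (commute_C_mul_X_pow hxz 1 1)).eq
  simpa only [add_zero] using exp_mul_of_lie (f₂ := 0) (f₃ := 0) (isNilpotent_C_mul_X_pow hx 1) hlie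
    (by rw [hcomm, smul_zero]) (by simp) (by simp)

lemma derivative_exp_mul_exp_mul_exp {x y z : R} (hx : IsNilpotent x) (hy : IsNilpotent y)
    (hz : IsNilpotent z) (h : ⁅x, y⁆ = (2 : ℚ) • z) (hxz : Commute x z) (hyz : Commute y z) :
    derivative (exp (C x * X ^ 1) * exp (C y * X ^ 1) * exp (C (-z) * X ^ 2)) =
      C (x + y) * (exp (C x * X ^ 1) * exp (C y * X ^ 1) * exp (C (-z) * X ^ 2)) := by
  have hpy := exp_C_mul_X_mul_C hx h hxz
  have hpq : Commute (exp (C x * X ^ 1) * exp (C y * X ^ 1)) (2 * (C z * X ^ 1)) :=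
    (Commute.ofNat_right _ 2).mul_right <|
      (commute_exp_right (commute_C_mul_X_pow hxz 1 1).symm).symm.mul_left
        (commute_exp_right (commute_C_mul_X_pow hyz 1 1).symm).symm
  have hp := derivative_exp_C_mul_X_pow hx 1
  have hq := derivative_exp_C_mul_X_pow hy 1
  have hr := derivative_exp_C_mul_X_pow hz.neg 2
  rw [Nat.cast_one, mul_one, Nat.sub_self, pow_zero, mul_one] at hp hq
  rw [show C (-z * (2 : ℕ)) * X ^ (2 - 1) = -(2 * (C z * X ^ 1)) by
    rw [Nat.cast_ofNat, mul_two, C_add, C_neg]; noncomm_ring] at hr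
  set p : R[X] := exp (C x * X ^ 1)
  set q : R[X] := exp (C y * X ^ 1)
  set r : R[X] := exp (C (-z) * X ^ 2)
  calc derivative (p * q * r)
      = C x * p * q * r + p * C y * q * r - p * q * (2 * (C z * X ^ 1)) * r := by
        rw [derivative_mul, derivative_mul, hp, hq, hr]; noncomm_ring
    _ = C x * p * q * r + (C y + 2 * (C z * X ^ 1)) * p * q * r
          - 2 * (C z * X ^ 1) * (p * q) * r := by rw [hpy, hpq.eq]
    _ = C (x + y) * (p * q * r) := by rw [C_add]; noncomm_ring

/-- The Baker–Campbell–Hausdorff formula for a central commutator: with `x`, `y`, `z` replaced by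
`x T`, `y T`, `z T ^ 2`, both sides solve `G' = (x + y) G`. -/
lemma exp_add_of_lie {x y z : R} (hx : IsNilpotent x) (hy : IsNilpotent y) (hz : IsNilpotent z)
    (h : ⁅x, y⁆ = (2 : ℚ) • z) (hxz : Commute x z) (hyz : Commute y z) :
    IsNilpotent (x + y) ∧ exp (x + y) = exp x * exp y * exp (-z) := by
  rw [← eval_one_exp_C_mul_X_pow hx 1, ← eval_one_exp_C_mul_X_pow hy 1,
    ← eval_one_exp_C_mul_X_pow hz.neg 2, ← eval_one_mul, ← eval_one_mul]
  refine exp_eq_eval_one_of_derivative ?_ (derivative_exp_mul_exp_mul_exp hx hy hz h hxz hyz)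
  rw [mul_coeff_zero, mul_coeff_zero, coeff_zero_exp_C_mul_X_pow hx one_ne_zero,
    coeff_zero_exp_C_mul_X_pow hy one_ne_zero, coeff_zero_exp_C_mul_X_pow hz.neg two_ne_zero,
    one_mul, one_mul]

lemma exp_mul_exp_of_commute_lie {x y z : R} (hx : IsNilpotent x) (hy : IsNilpotent y)
    (hz : IsNilpotent z) (h : ⁅x, y⁆ = z) (hxz : Commute x z) (hyz : Commute y z) :
    exp y * exp x = exp x * exp y * exp (-z) := by
  rw [mul_assoc, ← exp_add_of_commute hyz.neg_right hy hz.neg,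
    exp_mul_exp_of_lie (f₂ := 0) (f₃ := 0) hx hy h (by simp [hxz.lie_eq]) (by simp) (by simp)]
  congr 2; abel

lemma exp_mul_exp_of_short {x y f₁ f₂ h : R} (hx : IsNilpotent x) (hy : IsNilpotent y)
    (n₁ : IsNilpotent f₁) (n₂ : IsNilpotent f₂) (nh : IsNilpotent h)
    (xy : ⁅x, y⁆ = f₁) (xf₁ : ⁅x, f₁⁆ = (2 : ℚ) • f₂) (xf₂ : ⁅x, f₂⁆ = 0)
    (yf₁ : ⁅y, f₁⁆ = (2 : ℚ) • h) (yf₂ : Commute y f₂) (yh : Commute y h)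
    (ff : Commute f₁ f₂) (f₁h : Commute f₁ h) (f₂h : Commute f₂ h) :
    exp y * exp x = exp x * exp y * (exp (-f₁) * exp f₂ * exp h) := by
  have hsum : IsNilpotent (-f₁ + f₂) := ff.neg_left.isNilpotent_add n₁.neg n₂
  have hbch := (exp_add_of_lie (y := -f₁ + f₂) (z := -h) hy hsum nh.neg
    (by simp [yf₁, sub_eq_zero.2 yf₂.eq, Ring.lie_def y f₂]) yh.neg_right
    (f₁h.neg_left.add_left f₂h).neg_right).2
  calc exp y * exp x = exp x * exp (y + (-f₁ + f₂)) := by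
        rw [exp_mul_exp_of_lie (f₃ := 0) hx hy xy xf₁ (by simp [xf₂]) (by simp)]
        congr 2; abel
    _ = exp x * exp y * (exp (-f₁) * exp f₂ * exp h) := by
        rw [hbch, exp_add_of_commute ff.neg_left n₁.neg n₂, neg_neg]
        simp only [mul_assoc]

lemma exp_mul_exp_of_long {x y f₁ f₂ f₃ k : R} (hx : IsNilpotent x) (hy : IsNilpotent y)
    (n₁ : IsNilpotent f₁) (n₂ : IsNilpotent f₂) (n₃ : IsNilpotent f₃) (nk : IsNilpotent k)
    (xy : ⁅x, y⁆ = f₁) (xf₁ : ⁅x, f₁⁆ = (2 : ℚ) • f₂) (xf₂ : ⁅x, f₂⁆ = (3 : ℚ) • f₃)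
    (xf₃ : ⁅x, f₃⁆ = 0) (ff : ⁅f₁, f₂⁆ = (3 : ℚ) • k) (yf₁ : ⁅y, f₁⁆ = 0) (yf₂ : ⁅y, f₂⁆ = 0)
    (yk : Commute y k) (f₁f₃ : Commute f₁ f₃) (f₂f₃ : Commute f₂ f₃) (f₁k : Commute f₁ k)
    (f₂k : Commute f₂ k) (f₃k : Commute f₃ k) :
    exp y * exp x = exp x * exp y * (exp (-f₁) * exp f₂ * exp (-f₃) * exp k) := by
  have yf₃ : ⁅y, f₃⁆ = -k := by
    have jacobi := leibniz_lie y x f₂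
    rw [xf₂, lie_smul, ← lie_skew y x, xy, yf₂, lie_zero, add_zero, neg_lie, ff,
      ← smul_neg] at jacobi
    exact smul_right_injective R (three_ne_zero (α := ℚ)) jacobi
  obtain ⟨n₁₂, e₁₂⟩ := exp_add_of_lie (x := -f₁) (y := f₂) (z := (-(3 / 2) : ℚ) • k) n₁.neg n₂
    (nk.smul _) (by rw [neg_lie, ff, smul_smul]; norm_num) (f₁k.neg_left.smul_right _)
    (f₂k.smul_right _)
  have c₁₂₃ : Commute (-f₁ + f₂) (-f₃) := (f₁f₃.neg_left.add_left f₂f₃).neg_right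
  have ey := (exp_add_of_lie (x := y) (y := -f₁ + f₂ + -f₃) (z := (1 / 2 : ℚ) • k) hy
    (c₁₂₃.isNilpotent_add n₁₂ n₃.neg) (nk.smul _) (by simp [yf₁, yf₂, yf₃]) (yk.smul_right _)
    (((f₁k.neg_left.add_left f₂k).add_left f₃k.neg_left).smul_right _)).2
  have ek : exp k = exp ((3 / 2 : ℚ) • k) * exp ((-(1 / 2) : ℚ) • k) := by
    rw [← exp_add_of_commute (((Commute.refl k).smul_left _).smul_right _) (nk.smul _)
      (nk.smul _), ← add_smul]
    norm_num
  have ekf₃ : Commute (exp ((3 / 2 : ℚ) • k)) (exp (-f₃)) :=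
    commute_exp_exp (f₃k.symm.neg_right.smul_left _)
  calc exp y * exp x = exp x * exp (y + (-f₁ + f₂ + -f₃)) := by
        rw [exp_mul_exp_of_lie hx hy xy xf₁ xf₂ xf₃]
        congr 2; abel
    _ = exp x * exp y * (exp (-f₁) * exp f₂ * (exp ((3 / 2 : ℚ) • k) * exp (-f₃))
          * exp ((-(1 / 2) : ℚ) • k)) := by
        rw [ey, exp_add_of_commute c₁₂₃ n₁₂ n₃.neg, e₁₂, neg_smul, neg_neg, neg_smul]
        simp only [mul_assoc]
    _ = exp x * exp y * (exp (-f₁) * exp f₂ * exp (-f₃) * exp k) := by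
        rw [ekf₃.eq, ek]
        simp only [mul_assoc]

/-- Solving for `exp x * exp y` turns `k` into `2 k`: inverting the product of the last four factors
gives `exp (-k)`, and restoring their order contributes `exp (3 k)`. -/
lemma exp_mul_exp_of_long_swap {x y f₁ f₂ f₃ k : R} (n₁ : IsNilpotent f₁) (n₂ : IsNilpotent f₂)
    (n₃ : IsNilpotent f₃) (nk : IsNilpotent k) (ff : ⁅f₁, f₂⁆ = (3 : ℚ) • k)
    (f₁f₃ : Commute f₁ f₃) (f₂f₃ : Commute f₂ f₃) (f₁k : Commute f₁ k) (f₂k : Commute f₂ k)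
    (f₃k : Commute f₃ k)
    (hxy : exp y * exp x = exp x * exp y * (exp (-f₁) * exp f₂ * exp (-f₃) * exp k)) :
    exp x * exp y = exp y * exp x * (exp f₁ * exp (-f₂) * exp f₃ * exp ((2 : ℚ) • k)) := by
  have e₂₁ := exp_mul_exp_of_commute_lie n₁ n₂ (nk.smul _) ff (f₁k.smul_right _) (f₂k.smul_right _)
  have e₃ : exp k * exp ((2 : ℚ) • k) = exp ((3 : ℚ) • k) := by
    rw [← exp_add_of_commute ((Commute.refl k).smul_right _) nk (nk.smul _)]
    congr 1; module
  have ck : Commute (exp k) (exp f₁ * exp (-f₂) * exp f₃) :=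
    ((commute_exp_exp f₁k.symm).mul_right (commute_exp_exp f₂k.symm.neg_right)).mul_right
      (commute_exp_exp f₃k.symm)
  have cf₃ : Commute (exp (-f₃)) (exp f₁ * exp (-f₂)) :=
    (commute_exp_exp f₁f₃.symm.neg_left).mul_right (commute_exp_exp f₂f₃.symm.neg_left.neg_right)
  have c₃ : Commute (exp (-((3 : ℚ) • k))) (exp (-f₂)) :=
    commute_exp_exp (f₂k.symm.smul_left _).neg_left.neg_right
  have inv : exp (-f₁) * exp f₂ * exp (-f₃) * exp k *
      (exp f₁ * exp (-f₂) * exp f₃ * exp ((2 : ℚ) • k)) = 1 := by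
    calc _ = exp (-f₁) * exp f₂ * exp (-f₃) *
          (exp k * (exp f₁ * exp (-f₂) * exp f₃)) * exp ((2 : ℚ) • k) := by simp only [mul_assoc]
      _ = exp (-f₁) * exp f₂ * (exp (-f₃) * (exp f₁ * exp (-f₂))) * exp f₃ *
          (exp k * exp ((2 : ℚ) • k)) := by rw [ck.eq]; simp only [mul_assoc]
      _ = exp (-f₁) * (exp f₂ * exp f₁) * exp (-f₂) * (exp (-f₃) * exp f₃) *
          exp ((3 : ℚ) • k) := by rw [cf₃.eq, e₃]; simp only [mul_assoc]
      _ = exp (-f₁) * exp f₁ * (exp f₂ * (exp (-((3 : ℚ) • k)) * exp (-f₂))) *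
          exp ((3 : ℚ) • k) := by
        rw [e₂₁, exp_neg_mul_exp_self n₃]; simp only [mul_assoc, one_mul]
      _ = exp f₂ * exp (-f₂) * (exp (-((3 : ℚ) • k)) * exp ((3 : ℚ) • k)) := by
        rw [c₃.eq, exp_neg_mul_exp_self n₁]; simp only [mul_assoc, one_mul]
      _ = 1 := by rw [exp_mul_exp_neg_self n₂, exp_neg_mul_exp_self (nk.smul _), one_mul]
  rw [hxy, mul_assoc, inv, mul_one]

end Exp

open Module TensorProduct
open LieAlgebra.IsKilling (rootSystem)

/-! ### Roots and commutators -/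

lemma comm_eq_iff {G : Type*} [Group G] {g h p : G} : comm g h = p ↔ g * h = h * g * p := by
  rw [comm, mul_assoc, ← mul_inv_rev, inv_mul_eq_iff_eq_mul]

/-- The roots `ir + js` and the arguments `c_{ij} (-t)ⁱ uʲ` of the factors of a commutator formula,
for `(i, j)` running through a list. -/
def commFactors {V K : Type*} [AddCommMonoid V] [CommRing K] (c : ℕ → ℕ → ℤ) (r s : V)
    (l : List (ℕ × ℕ)) (t u : K) : List (V × K) :=
  l.map fun q => (q.1 • r + q.2 • s, (c q.1 q.2 : K) * (-t) ^ q.1 * u ^ q.2)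

lemma map_commFactors {V A K : Type*} [AddCommMonoid V] [CommRing A] [CommRing K] (f : A →+* K)
    (c : ℕ → ℕ → ℤ) (r s : V) (l : List (ℕ × ℕ)) (t u : A) :
    (commFactors c r s l t u).map (Prod.map id f) = commFactors c r s l (f t) (f u) := by
  simp [commFactors]

lemma prod_map_filter {α M : Type*} [Monoid M] (P : α → Prop) [DecidablePred P] (f : α → M)
    (l : List α) (h : ∀ x ∈ l, ¬P x → f x = 1) : ((l.filter P).map f).prod = (l.map f).prod := by
  induction l with
  | nil => rfl
  | cons x l ih =>
    rw [List.forall_mem_cons] at h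
    by_cases hx : P x <;> simp [hx, ih h.2, h.1]

lemma smul_add_smul_ne_zero {V : Type*} [AddCommGroup V] [Module ℂ V] {r s : V}
    (h : LinearIndependent ℂ ![r, s]) {m : ℤ} (hm : m ≠ 0) (n : ℤ) : m • r + n • s ≠ 0 := by
  rw [← Int.cast_smul_eq_zsmul ℂ, ← Int.cast_smul_eq_zsmul ℂ]
  exact fun h₀ => hm (by exact_mod_cast (LinearIndependent.pair_iff.1 h _ _ h₀).1)

variable {L : Type*} [LieRing L] [LieAlgebra ℂ L] [FiniteDimensional ℂ L]
  [LieAlgebra.IsSimple ℂ L] {H : LieSubalgebra ℂ L} [H.IsCartanSubalgebra]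

lemma neg_mem_roots_iff {r : Dual ℂ H} : -r ∈ roots H ↔ r ∈ roots H :=
  (rootSystem H).neg_mem_range_root_iff

lemma ne_zero_of_mem_roots {r : Dual ℂ H} (hr : r ∈ roots H) : r ≠ 0 := by
  obtain ⟨i, rfl⟩ := hr
  exact (rootSystem H).ne_zero i

lemma linearIndependent_of_add_mem_roots {r s : Dual ℂ H} (hr : r ∈ roots H) (hs : s ∈ roots H)
    (hrs : r + s ∈ roots H) : LinearIndependent ℂ ![r, s] := by
  obtain ⟨i, rfl⟩ := hr
  obtain ⟨j, rfl⟩ := hs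
  exact (rootSystem H).linearIndependent_of_add_mem_range_root' hrs

/-- Every root `ir + js` with `i, j > 0` has `(i, j)` in the list. -/
def CombinationsIn (r s : Dual ℂ H) (l : List (ℕ × ℕ)) : Prop :=
  ∀ i j : ℕ, 0 < i → 0 < j → i • r + j • s ∈ roots H → (i, j) ∈ l

namespace ChevalleyBasis

variable (B : ChevalleyBasis H)

/-! ### Change of the coefficient ring -/

section Transfer

variable {A K : Type*} [CommRing A] [CommRing K] (f : A →+* K)

/-- The map `A ⊗ L_ℤ → K ⊗ L_ℤ` induced by a ring homomorphism `A → K`; it intertwines the root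
elements over `A` with those over `K`. -/
noncomputable def latticeMap : A ⊗[ℤ] B.lattice →ₗ[ℤ] K ⊗[ℤ] B.lattice :=
  f.toIntAlgHom.toLinearMap.rTensor B.lattice

@[simp] lemma latticeMap_tmul (a : A) (v : B.lattice) :
    B.latticeMap f (a ⊗ₜ v) = f a ⊗ₜ v := rfl

lemma latticeMap_injective (hf : Function.Injective f) : Function.Injective (B.latticeMap f) := by
  have : Module.Flat ℤ B.lattice := by
    have : IsAddTorsionFree L := IsAddTorsionFree.of_isTorsionFree ℂ L
    rw [IsDedekindDomain.flat_iff_torsion_eq_bot, ← Submodule.isTorsionFree_iff_torsion_eq_bot]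
    infer_instance
  exact Module.Flat.rTensor_preserves_injective_linearMap _ hf

lemma latticeMap_expEnd (r : Dual ℂ H) (a : A) (v : A ⊗[ℤ] B.lattice) :
    B.latticeMap f (B.expEnd A r a v) = B.expEnd K r (f a) (B.latticeMap f v) := by
  induction v using TensorProduct.induction_on with
  | zero => simp only [map_zero]
  | add v w hv hw => simp only [map_add, hv, hw]
  | tmul b v =>
    simp only [expEnd, LinearMap.sum_apply, LinearMap.smul_apply, LinearMap.baseChange_tmul,
      map_sum, latticeMap_tmul, smul_tmul', smul_eq_mul, map_mul, map_pow]

/-- The product of the root elements `x_r(a)` over the entries `(r, a)` of a list. -/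
noncomputable def expEndProd (l : List (Dual ℂ H × A)) : Module.End A (A ⊗[ℤ] B.lattice) :=
  (l.map fun p => B.expEnd A p.1 p.2).prod

lemma latticeMap_expEndProd (l : List (Dual ℂ H × A)) (v : A ⊗[ℤ] B.lattice) :
    B.latticeMap f (B.expEndProd l v) =
      B.expEndProd (l.map (Prod.map id f)) (B.latticeMap f v) := by
  induction l with
  | nil => rfl
  | cons p l ih =>
    simp only [expEndProd, List.map_cons, List.prod_cons, Module.End.mul_apply] at ih ⊢
    rw [latticeMap_expEnd, ih]
    rfl

lemma expEndProd_map_eq {l l' : List (Dual ℂ H × A)} (h : B.expEndProd l = B.expEndProd l') :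
    B.expEndProd (l.map (Prod.map id f)) = B.expEndProd (l'.map (Prod.map id f)) := by
  refine TensorProduct.AlgebraTensorModule.curry_injective ?_
  ext v
  have hv := congrArg (B.latticeMap f) (LinearMap.congr_fun h (1 ⊗ₜ v))
  rw [latticeMap_expEndProd, latticeMap_expEndProd, latticeMap_tmul, map_one] at hv
  exact hv

lemma expEndProd_eq_of_injective (hf : Function.Injective f) {l l' : List (Dual ℂ H × A)}
    (h : B.expEndProd (l.map (Prod.map id f)) = B.expEndProd (l'.map (Prod.map id f))) :
    B.expEndProd l = B.expEndProd l' := by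
  refine LinearMap.ext fun v => B.latticeMap_injective f hf ?_
  rw [latticeMap_expEndProd, latticeMap_expEndProd, h]

/-- The product of the root elements `x_{ir+js}(c_{ij} (-t)ⁱ uʲ)`, for `(i, j)` running through a
list. Unlike in `rootProduct`, some of the `ir + js` may fail to be roots, in which case the factor
is trivial. -/
noncomputable def commProduct (c : ℕ → ℕ → ℤ) (r s : Dual ℂ H) (l : List (ℕ × ℕ)) (t u : K) :
    B.chevalleyGroup K :=
  ((commFactors c r s l t u).map fun p => B.x p.1 p.2).prod

lemma comm_eq_commProduct_iff {c : ℕ → ℕ → ℤ} {r s : Dual ℂ H} {l : List (ℕ × ℕ)} {t u : K} :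
    comm (B.x s u) (B.x r t) = B.commProduct c r s l t u ↔
      B.expEndProd [(s, u), (r, t)] =
        B.expEndProd ((r, t) :: (s, u) :: commFactors c r s l t u) := by
  have val_prod (m : List (Dual ℂ H × K)) :
      (((m.map fun p => B.x p.1 p.2).prod : B.chevalleyGroup K) :
        LinearMap.GeneralLinearGroup K (K ⊗[ℤ] B.lattice)).val = B.expEndProd m := by
    rw [← Subgroup.coe_subtype, ← Units.coeHom_apply, map_list_prod, map_list_prod, List.map_map,
      List.map_map]
    rfl
  rw [comm_eq_iff, ← val_prod, ← val_prod, Units.val_inj, Subtype.val_inj]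
  simp only [List.map_cons, List.map_nil, List.prod_cons, List.prod_nil, mul_one, mul_assoc,
    commProduct]

lemma comm_eq_commProduct_of_forall_field {c : ℕ → ℕ → ℤ} {r s : Dual ℂ H} {l : List (ℕ × ℕ)}
    (h : ∀ (F : Type) [Field F] [CharZero F] (t u : F),
      comm (B.x s u) (B.x r t) = B.commProduct c r s l t u) (t u : K) :
    comm (B.x s u) (B.x r t) = B.commProduct c r s l t u := by
  have generic : B.expEndProd [(s, MvPolynomial.X 1), (r, MvPolynomial.X 0)] =
      B.expEndProd ((r, MvPolynomial.X 0) :: (s, MvPolynomial.X 1) ::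
        commFactors c r s l (MvPolynomial.X 0 : MvPolynomial (Fin 2) ℤ) (MvPolynomial.X 1)) := by
    refine B.expEndProd_eq_of_injective
      (algebraMap _ (FractionRing (MvPolynomial (Fin 2) ℤ))) (IsFractionRing.injective _ _) ?_
    simpa only [List.map_cons, List.map_nil, Prod.map_apply, id_eq, map_commFactors] using
      B.comm_eq_commProduct_iff.1 (h _ _ _)
  have specialized := B.expEndProd_map_eq (MvPolynomial.aeval ![t, u]).toRingHom generic
  rw [comm_eq_commProduct_iff]
  simp only [List.map_cons, List.map_nil, Prod.map_apply, id_eq, map_commFactors]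
    at specialized
  simpa using specialized

end Transfer

/-! ### Structure constants -/

lemma lie_e_of_add_ne_zero {r s : Dual ℂ H} (h : r + s ≠ 0) :
    ⁅B.e r, B.e s⁆ = B.N r s • B.e (r + s) := by
  by_cases hr : r ∈ roots H
  swap; · rw [B.N_eq_zero r s fun h => hr h.1, B.e_eq_zero r hr, zero_lie, zero_smul]
  by_cases hs : s ∈ roots H
  swap; · rw [B.N_eq_zero r s fun h => hs h.2.1, B.e_eq_zero s hs, lie_zero, zero_smul]
  by_cases hrs : r + s ∈ roots H
  · exact B.lie_e_e r hr s hs hrs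
  · rw [B.N_eq_zero r s fun h => hrs h.2.2, B.lie_eq_zero hr hs h hrs, zero_smul]

lemma e_ne_zero {r : Dual ℂ H} (hr : r ∈ roots H) : B.e r ≠ 0 := by
  obtain ⟨i, rfl⟩ := hr
  intro h
  have hi := B.lie_e_neg i
  rw [h, zero_lie] at hi
  exact (rootSystem H).flip.ne_zero i (Subtype.ext hi.symm)

lemma zsmul_e_injective {r : Dual ℂ H} (hr : r ∈ roots H) :
    Function.Injective fun n : ℤ => n • B.e r :=
  have : IsAddTorsionFree L := .of_isTorsionFree ℂ L
  smul_left_injective ℤ (B.e_ne_zero hr)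

lemma N_swap (r s : Dual ℂ H) : B.N s r = -B.N r s := by
  by_cases h : r ∈ roots H ∧ s ∈ roots H ∧ r + s ∈ roots H
  · obtain ⟨hr, hs, hrs⟩ := h
    refine B.zsmul_e_injective hrs ?_
    change B.N s r • B.e (r + s) = -B.N r s • B.e (r + s)
    rw [neg_smul, ← B.lie_e_e r hr s hs hrs, lie_skew, add_comm r s,
      B.lie_e_e s hs r hr (add_comm r s ▸ hrs)]
  · rw [B.N_eq_zero r s h, B.N_eq_zero s r (by rw [add_comm]; tauto), neg_zero]

lemma N_jacobi {r s w : Dual ℂ H} (hrs : r + s ≠ 0) (hsw : s + w ≠ 0) (hwr : w + r ≠ 0)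
    (h : r + s + w ∈ roots H) :
    B.N r s * B.N (r + s) w + B.N s w * B.N (s + w) r + B.N w r * B.N (w + r) s = 0 := by
  have h₀ := ne_zero_of_mem_roots h
  have e₁ : w + (r + s) = r + s + w := by abel
  have e₂ : r + (s + w) = r + s + w := by abel
  have e₃ : s + (w + r) = r + s + w := by abel
  have jacobi := lie_jacobi (B.e w) (B.e r) (B.e s)
  rw [B.lie_e_of_add_ne_zero hrs, B.lie_e_of_add_ne_zero hsw, B.lie_e_of_add_ne_zero hwr, lie_smul,
    lie_smul, lie_smul, B.lie_e_of_add_ne_zero (e₁ ▸ h₀), B.lie_e_of_add_ne_zero (e₂ ▸ h₀),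
    B.lie_e_of_add_ne_zero (e₃ ▸ h₀), e₁, e₂, e₃] at jacobi
  simp only [B.N_swap (r + s) w, B.N_swap (s + w) r, B.N_swap (w + r) s, smul_smul, ← add_smul]
    at jacobi
  have := B.zsmul_e_injective h (jacobi.trans (zero_smul ℤ _).symm)
  linear_combination -this

lemma lie_e_neg_coroot (i : H.root) :
    ⁅B.e (-(rootSystem H).root i), ((rootSystem H).coroot i : L)⁆ =
      (2 : ℂ) • B.e (-(rootSystem H).root i) := by
  rw [B.lie_coroot i (neg_mem_roots_iff.2 ⟨i, rfl⟩), LinearMap.neg_apply,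
    show (rootSystem H).root i ((rootSystem H).coroot i) = 2 from (rootSystem H).root_coroot_two i,
    neg_smul, neg_neg]

lemma exists_killingForm_e_eq {r : Dual ℂ H} (hr : r ∈ roots H) :
    ∃ n : ℤ, 0 < n ∧ 2 * killingForm ℂ L (B.e r) (B.e (-r)) = n := by
  obtain ⟨i, rfl⟩ := hr
  refine ⟨∑ j, (rootSystem H).pairingIn ℤ j i ^ 2, ?_, ?_⟩
  · refine Finset.sum_pos' (fun j _ => sq_nonneg _) ⟨i, Finset.mem_univ _, ?_⟩
    rw [RootPairing.pairingIn_same]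
    norm_num
  · rw [← smul_eq_mul, ← map_smul, ← B.lie_e_neg_coroot, ← LieModule.traceForm_apply_lie_apply,
      B.lie_e_neg]
    have hκ := congrArg (fun β => β ((rootSystem H).coroot i) ((rootSystem H).coroot i))
      (LieAlgebra.IsKilling.corootForm_rootSystem_eq_killing (K := ℂ) (L := L) (H := H))
    refine hκ.symm.trans ?_
    simp only [RootPairing.corootForm_apply_apply, Int.cast_sum]
    refine Finset.sum_congr rfl fun j _ => ?_
    have pairing_eq := (rootSystem H).algebraMap_pairingIn ℤ j i
    rw [Int.cast_pow, sq, ← eq_intCast (algebraMap ℤ ℂ), pairing_eq]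
    rfl

lemma N_mul_abs_N_cyclic {r s w : Dual ℂ H} (h : r + s + w = 0) :
    B.N r s * |B.N s w| = B.N s w * |B.N r s| := by
  have hsw : s + w = -r := by rw [eq_neg_iff_add_eq_zero, ← h]; abel
  have hrs : r + s = -w := by rw [eq_neg_iff_add_eq_zero, ← h]
  by_cases hroots : r ∈ roots H ∧ s ∈ roots H ∧ w ∈ roots H
  swap
  · rw [B.N_eq_zero r s (by rw [hrs, neg_mem_roots_iff]; tauto),
      B.N_eq_zero s w (by rw [hsw, neg_mem_roots_iff]; tauto)]
  obtain ⟨hr, hs, hw⟩ := hroots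
  obtain ⟨m, hm, hm'⟩ := B.exists_killingForm_e_eq (neg_mem_roots_iff.2 hw)
  obtain ⟨n, hn, hn'⟩ := B.exists_killingForm_e_eq hr
  have invariance := LieModule.traceForm_apply_lie_apply ℂ L L (B.e r) (B.e s) (B.e w)
  rw [B.lie_e_e r hr s hs (hrs ▸ neg_mem_roots_iff.2 hw),
    B.lie_e_e s hs w hw (hsw ▸ neg_mem_roots_iff.2 hr), hrs, hsw] at invariance
  have hmn : B.N r s * m = B.N s w * n := by
    rw [neg_neg] at hm'
    have : (B.N r s * m : ℂ) = B.N s w * n := by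
      rw [← hm', ← hn', mul_left_comm, mul_left_comm (B.N s w : ℂ)]
      simpa [killingForm] using invariance
    exact_mod_cast this
  rw [← mul_left_inj' (mul_pos hm hn).ne']
  have habs : |B.N r s| * m = |B.N s w| * n := by
    simpa only [abs_mul, abs_of_pos hm, abs_of_pos hn] using congrArg abs hmn
  linear_combination |B.N s w| * n * hmn - B.N s w * n * habs

lemma N_mul_N_neg_eq_sub {i : H.root} {s : Dual ℂ H} (hs : s ∈ roots H)
    (h₁ : (rootSystem H).root i + s ≠ 0) (h₂ : -(rootSystem H).root i + s ≠ 0) {m : ℤ}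
    (hm : s ((rootSystem H).coroot i) = m) :
    B.N ((rootSystem H).root i) s * B.N (-(rootSystem H).root i) ((rootSystem H).root i + s) =
      B.N (-(rootSystem H).root i) s *
        B.N ((rootSystem H).root i) (-(rootSystem H).root i + s) - m := by
  have coroot_eq := B.lie_e_neg i
  generalize (rootSystem H).root i = r at *
  have leibniz := leibniz_lie (B.e (-r)) (B.e r) (B.e s)
  rw [← lie_skew (B.e (-r)) (B.e r), coroot_eq, neg_lie, lie_skew, B.lie_coroot i hs, hm,
    Int.cast_smul_eq_zsmul, B.lie_e_of_add_ne_zero h₁, B.lie_e_of_add_ne_zero h₂, lie_smul,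
    lie_smul, B.lie_e_of_add_ne_zero (by simpa using ne_zero_of_mem_roots hs),
    B.lie_e_of_add_ne_zero (by simpa using ne_zero_of_mem_roots hs), neg_add_cancel_left,
    add_neg_cancel_left, smul_smul, smul_smul, ← neg_smul, ← add_smul] at leibniz
  rw [B.zsmul_e_injective hs leibniz]
  ring

lemma N_mul_N_neg_eq_sub_add (i j : H.root)
    (hij : LinearIndependent ℂ ![(rootSystem H).root i, (rootSystem H).root j]) :
    B.N ((rootSystem H).root i) ((rootSystem H).root j) *
        B.N (-(rootSystem H).root i) ((rootSystem H).root i + (rootSystem H).root j) =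
      B.N (-(rootSystem H).root i) ((rootSystem H).root j) *
          B.N ((rootSystem H).root i) (-(rootSystem H).root i + (rootSystem H).root j) -
        (rootSystem H).chainBotCoeff i j + (rootSystem H).chainTopCoeff i j := by
  have pairing_eq : (rootSystem H).root j ((rootSystem H).coroot i) =
      (((rootSystem H).chainBotCoeff i j - (rootSystem H).chainTopCoeff i j : ℤ) : ℂ) := by
    rw [RootPairing.chainBotCoeff_sub_chainTopCoeff hij, ← eq_intCast (algebraMap ℤ ℂ),
      RootPairing.algebraMap_pairingIn]
    rfl
  rw [B.N_mul_N_neg_eq_sub ⟨j, rfl⟩ (by simpa using smul_add_smul_ne_zero hij one_ne_zero 1)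
    (by simpa using smul_add_smul_ne_zero hij (neg_ne_zero.2 one_ne_zero) 1) pairing_eq]
  ring

lemma N_mul_N_neg (i j : H.root)
    (hij : LinearIndependent ℂ ![(rootSystem H).root i, (rootSystem H).root j]) :
    B.N ((rootSystem H).root i) ((rootSystem H).root j) *
        B.N (-(rootSystem H).root i) ((rootSystem H).root i + (rootSystem H).root j) =
      ((rootSystem H).chainBotCoeff i j + 1) * (rootSystem H).chainTopCoeff i j := by
  have sub_mem_iff {j : H.root}
      (hij : LinearIndependent ℂ ![(rootSystem H).root i, (rootSystem H).root j]) :=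
    (rootSystem H).root_sub_nsmul_mem_range_iff_le_chainBotCoeff hij (n := 1)
  simp only [one_smul] at sub_mem_iff
  induction hn : (rootSystem H).chainBotCoeff i j generalizing j with
  | zero =>
    have hN : B.N (-(rootSystem H).root i) ((rootSystem H).root j) = 0 :=
      B.N_eq_zero _ _ fun h => by
        rw [neg_add_eq_sub] at h
        have := (sub_mem_iff hij).1 h.2.2
        omega
    rw [B.N_mul_N_neg_eq_sub_add i j hij, hN, hn]
    push_cast
    ring
  | succ n ih =>
    obtain ⟨k, hk⟩ := (sub_mem_iff hij).2 (by omega)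
    have hj := eq_add_of_sub_eq hk.symm
    have hik : LinearIndependent ℂ ![(rootSystem H).root i, (rootSystem H).root k] :=
      LinearIndependent.pair_add_right_iff.1 (by rwa [add_comm, ← hj])
    have hbot := RootPairing.chainBotCoeff_of_add hik hj
    have htop := RootPairing.chainTopCoeff_of_add hik hj
    have hk' := ih k hik (by omega)
    rw [htop, add_comm _ ((rootSystem H).root k), ← hj, hk, ← neg_add_eq_sub] at hk'
    rw [B.N_mul_N_neg_eq_sub_add i j hij, mul_comm, hk', hn]
    push_cast
    ring

lemma N_mul_N_neg_pos {r s : Dual ℂ H} (hr : r ∈ roots H) (hs : s ∈ roots H)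
    (hrs : r + s ∈ roots H) : 0 < B.N r s * B.N (-r) (r + s) := by
  obtain ⟨i, rfl⟩ := hr
  obtain ⟨j, rfl⟩ := hs
  rw [B.N_mul_N_neg i j (linearIndependent_of_add_mem_roots ⟨i, rfl⟩ ⟨j, rfl⟩ hrs)]
  have := (rootSystem H).one_le_chainTopCoeff_of_root_add_mem hrs
  positivity

lemma abs_N_neg (r s : Dual ℂ H) : |B.N (-r) (-s)| = |B.N r s| := by
  by_cases h : r ∈ roots H ∧ s ∈ roots H ∧ r + s ∈ roots H
  · obtain ⟨⟨i, rfl⟩, ⟨j, rfl⟩, hrs⟩ := h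
    have root_neg (k : H.root) :
        -(rootSystem H).root k = (rootSystem H).root ((rootSystem H).reflectionPerm k k) := by
      simp [-LieAlgebra.IsKilling.rootSystem_root_apply]
    have hrs' := neg_mem_roots_iff.2 hrs
    rw [neg_add, root_neg i, root_neg j] at hrs'
    rw [root_neg i, root_neg j, B.abs_N _ _ hrs, B.abs_N _ _ hrs',
      RootPairing.chainBotCoeff_reflectionPerm_left,
      RootPairing.chainTopCoeff_reflectionPerm_right]
  · rw [B.N_eq_zero r s h, B.N_eq_zero (-r) (-s)]
    rwa [← neg_add, neg_mem_roots_iff, neg_mem_roots_iff, neg_mem_roots_iff]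

lemma N_neg (r s : Dual ℂ H) : B.N (-r) (-s) = -B.N r s := by
  by_cases h : r ∈ roots H ∧ s ∈ roots H ∧ r + s ∈ roots H
  · have hpos := B.N_mul_N_neg_pos h.1 h.2.1 h.2.2
    have cyclic := B.N_mul_abs_N_cyclic (r := -s) (s := -r) (w := r + s) (by abel)
    have habs := B.abs_N_neg r s
    rw [B.N_swap (-r) (-s), abs_neg, habs] at cyclic
    rcases pos_and_pos_or_neg_and_neg_of_mul_pos hpos with ⟨h₁, h₂⟩ | ⟨h₁, h₂⟩
    · rw [abs_of_pos h₁, abs_of_pos h₂] at cyclic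
      exact mul_right_cancel₀ h₂.ne' (by linear_combination -cyclic)
    · rw [abs_of_neg h₁, abs_of_neg h₂] at cyclic
      exact mul_right_cancel₀ h₂.ne (by linear_combination cyclic)
  · rw [B.N_eq_zero r s h, B.N_eq_zero (-r) (-s), neg_zero]
    rwa [← neg_add, neg_mem_roots_iff, neg_mem_roots_iff, neg_mem_roots_iff]

/-! ### The commutator formula over a field -/

section Field

open IsNilpotent (exp)

lemma latticeDiv_one_apply (r : Dual ℂ H) (v : B.lattice) :
    (B.latticeDiv r 1 v : L) = ⁅B.e r, (v : L)⁆ := by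
  simp [latticeDiv, adDiv]

lemma latticeDiv_one_of_notMem {r : Dual ℂ H} (hr : r ∉ roots H) : B.latticeDiv r 1 = 0 := by
  ext v
  rw [latticeDiv_one_apply, B.e_eq_zero r hr, zero_lie]
  rfl

lemma lie_latticeDiv_one {r s : Dual ℂ H} (h : r + s ≠ 0) :
    ⁅B.latticeDiv r 1, B.latticeDiv s 1⁆ = B.N r s • B.latticeDiv (r + s) 1 := by
  ext v
  rw [LinearMap.smul_apply, Submodule.coe_smul, latticeDiv_one_apply, ← smul_lie,
    ← B.lie_e_of_add_ne_zero h, lie_lie, ← latticeDiv_one_apply, ← latticeDiv_one_apply]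
  simp only [← latticeDiv_one_apply]
  rfl

lemma latticeDiv_one_pow (r : Dual ℂ H) (n : ℕ) :
    B.latticeDiv r 1 ^ n = n.factorial • B.latticeDiv r n := by
  induction n with
  | zero => rw [pow_zero, latticeDiv_zero, Nat.factorial_zero, one_smul]
  | succ n ih =>
    rw [pow_succ, ih, smul_mul_assoc, latticeDiv_mul, smul_smul, Nat.choose_symm_add,
      Nat.choose_one_right, mul_comm, ← Nat.factorial_succ]

variable (K : Type*) [CommRing K]

/-- The operator `a ad(e_{ir+js})` on `K ⊗ L_ℤ`. -/
noncomputable def adString (r s : Dual ℂ H) (i j : ℕ) (a : K) : Module.End K (K ⊗[ℤ] B.lattice) :=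
  a • (B.latticeDiv (i • r + j • s) 1).baseChange K

lemma adString_pow (r s : Dual ℂ H) (i j : ℕ) (a : K) (n : ℕ) :
    B.adString K r s i j a ^ n =
      n.factorial • a ^ n • (B.latticeDiv (i • r + j • s) n).baseChange K := by
  rw [adString, smul_pow, ← LinearMap.baseChange_pow, latticeDiv_one_pow,
    ← Nat.cast_smul_eq_nsmul ℤ n.factorial, LinearMap.baseChange_smul, smul_comm,
    Nat.cast_smul_eq_nsmul]

lemma isNilpotent_adString (r s : Dual ℂ H) (i j : ℕ) (a : K) :
    IsNilpotent (B.adString K r s i j a) :=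
  ⟨_, by rw [adString_pow, B.latticeDiv_eq_zero _ le_rfl, LinearMap.baseChange_zero, smul_zero,
    smul_zero]⟩

lemma lie_adString {r s : Dual ℂ H} (h : LinearIndependent ℂ ![r, s]) {i k : ℕ} (hik : i + k ≠ 0)
    (j l : ℕ) (a b : K) :
    ⁅B.adString K r s i j a, B.adString K r s k l b⁆ =
      B.adString K r s (i + k) (j + l) (a * b * B.N (i • r + j • s) (k • r + l • s)) := by
  have add_eq : i • r + j • s + (k • r + l • s) = (i + k) • r + (j + l) • s := by module
  have ne_zero : (i + k) • r + (j + l) • s ≠ 0 := by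
    simpa only [← natCast_zsmul] using
      smul_add_smul_ne_zero h (m := ((i + k : ℕ) : ℤ)) (by exact_mod_cast hik) ((j + l : ℕ) : ℤ)
  have lie_smul_smul (X Y : Module.End K (K ⊗[ℤ] B.lattice)) :
      ⁅a • X, b • Y⁆ = (a * b) • ⁅X, Y⁆ := by
    rw [Ring.lie_def, Ring.lie_def, smul_mul_smul_comm, smul_mul_smul_comm, mul_comm b a]
    exact (smul_sub _ _ _).symm
  have zsmul_eq (n : ℤ) (X : Module.End K (K ⊗[ℤ] B.lattice)) : n • X = (n : K) • X :=
    LinearMap.ext fun v => (Int.cast_smul_eq_zsmul K n (X v)).symm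
  rw [adString, adString, adString, lie_smul_smul, Ring.lie_def, ← LinearMap.baseChange_mul,
    ← LinearMap.baseChange_mul, ← LinearMap.baseChange_sub, ← Ring.lie_def,
    B.lie_latticeDiv_one (add_eq ▸ ne_zero), add_eq, LinearMap.baseChange_smul,
    zsmul_eq, smul_smul]

lemma adString_of_notMem {r s : Dual ℂ H} {i j : ℕ} (h : i • r + j • s ∉ roots H) (a : K) :
    B.adString K r s i j a = 0 := by
  rw [adString, B.latticeDiv_one_of_notMem h, LinearMap.baseChange_zero, smul_zero]

lemma neg_adString (r s : Dual ℂ H) (i j : ℕ) (a : K) :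
    -B.adString K r s i j a = B.adString K r s i j (-a) :=
  LinearMap.ext fun v =>
    (neg_smul a ((B.latticeDiv (i • r + j • s) 1).baseChange K v)).symm

variable {K} in
lemma lie_adString_of_notMem {r s : Dual ℂ H} (h : LinearIndependent ℂ ![r, s]) {i j k l : ℕ}
    (hik : i + k ≠ 0) (hn : (i + k) • r + (j + l) • s ∉ roots H) (a b : K) :
    ⁅B.adString K r s i j a, B.adString K r s k l b⁆ = 0 := by
  rw [B.lie_adString K h hik, B.adString_of_notMem K hn]

variable {F : Type*} [Field F] [CharZero F]

lemma expEnd_eq_exp_adString (r s : Dual ℂ H) (i j : ℕ) (a : F) :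
    B.expEnd F (i • r + j • s) a = exp (B.adString F r s i j a) := by
  rw [IsNilpotent.exp_eq_sum (by rw [adString_pow, B.latticeDiv_eq_zero _ le_rfl,
    LinearMap.baseChange_zero, smul_zero, smul_zero]), expEnd]
  refine Finset.sum_congr rfl fun n _ => ?_
  rw [adString_pow, ← Nat.cast_smul_eq_nsmul ℚ n.factorial, inv_smul_smul₀ (by positivity)]

lemma rat_smul_adString (r s : Dual ℂ H) (i j : ℕ) (a : F) (q : ℚ) :
    q • B.adString F r s i j a = B.adString F r s i j (q * a) := by
  rw [adString, adString, mul_smul, Rat.cast_smul_eq_qsmul]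

/-- The integers `c i j` are the constants `C_{ij,rs}` of the commutator formula for `r` and `s`. -/
def HasConstants (c : ℕ → ℕ → ℤ) (r s : Dual ℂ H) : Prop :=
  ∀ i j : ℕ, 0 < i → 0 < j → i • r + j • s ∈ roots H → (c i j : ℚ) = B.C i j r s

lemma C_one_one (r s : Dual ℂ H) : B.C 1 1 r s = B.N r s := by
  simp [C, M]

lemma C_two_one (r s : Dual ℂ H) : B.C 2 1 r s = B.N r s * B.N r (r + s) / 2 := by
  simp [C, M, Finset.prod_range_succ]

lemma C_one_two (r s : Dual ℂ H) : B.C 1 2 r s = -(B.N r s * B.N s (r + s)) / 2 := by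
  simp [C, M, Finset.prod_range_succ, B.N_swap r s, add_comm s r]

lemma C_three_one (r s : Dual ℂ H) :
    B.C 3 1 r s = B.N r s * B.N r (r + s) * B.N r (2 • r + s) / 6 := by
  simp [C, M, Finset.prod_range_succ, Nat.factorial]

lemma C_one_three (r s : Dual ℂ H) :
    B.C 1 3 r s = B.N r s * B.N s (r + s) * B.N s (r + 2 • s) / 6 := by
  simp only [C, M, Finset.prod_range_succ, Finset.prod_range_zero, zero_smul, zero_add, one_smul,
    one_mul, add_comm s r, add_comm (2 • s) r, B.N_swap r s, Nat.factorial]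
  push_cast
  ring

lemma C_three_two (r s : Dual ℂ H) :
    B.C 3 2 r s = -(B.N r (r + s) * B.N (r + s) (2 • r + s)) / 6 := by
  have h : r + s + r = 2 • r + s := by module
  simp only [C, M, Finset.prod_range_succ, Finset.prod_range_zero, zero_smul, zero_add, one_smul,
    one_mul, h, B.N_swap r (r + s), Nat.factorial]
  push_cast
  ring

lemma C_two_three (r s : Dual ℂ H) :
    B.C 2 3 r s = B.N s (r + s) * B.N (r + s) (r + 2 • s) / 3 := by
  have h : r + s + s = r + 2 • s := by module
  simp only [C, M, Finset.prod_range_succ, Finset.prod_range_zero, zero_smul, zero_add, one_smul,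
    one_mul, add_comm s r, h, B.N_swap s (r + s), Nat.factorial]
  push_cast
  ring

variable {r s : Dual ℂ H} {c : ℕ → ℕ → ℤ} {l : List (ℕ × ℕ)}

lemma commute_adString {K : Type*} [CommRing K] (h : LinearIndependent ℂ ![r, s])
    (hl : CombinationsIn r s l)
    {i j k m : ℕ} (a b : K) (hik : 0 < i + k := by decide) (hjm : 0 < j + m := by decide)
    (hn : (i + k, j + m) ∉ l := by decide) :
    Commute (B.adString K r s i j a) (B.adString K r s k m b) :=
  sub_eq_zero.1 <| B.lie_adString_of_notMem h hik.ne' (fun hm => hn (hl _ _ hik hjm hm)) a b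

lemma lie_adString_eq_smul (h : LinearIndependent ℂ ![r, s]) {i j k l m n : ℕ} (hm : i + k = m)
    (hn : j + l = n) (hm₀ : m ≠ 0) {a b d : F} {q : ℚ}
    (hd : a * b * B.N (i • r + j • s) (k • r + l • s) = q * d) :
    ⁅B.adString F r s i j a, B.adString F r s k l b⁆ = q • B.adString F r s m n d := by
  subst hm hn
  rw [B.lie_adString F h hm₀, hd, rat_smul_adString]

lemma expEnd_eq_exp_adString_C (hc : B.HasConstants c r s) {i j : ℕ} (hi : 0 < i) (hj : 0 < j)
    (a b : F) :
    B.expEnd F (i • r + j • s) (c i j * a * b) =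
      exp (B.adString F r s i j (B.C i j r s * a * b)) := by
  rw [expEnd_eq_exp_adString]
  by_cases h : i • r + j • s ∈ roots H
  · rw [← hc i j hi hj h, Rat.cast_intCast]
  · rw [B.adString_of_notMem F h, B.adString_of_notMem F h]

lemma comm_eq_commProduct_iff_exp (hc : B.HasConstants c r s) (hl : ∀ q ∈ l, 0 < q.1 ∧ 0 < q.2)
    (t u : F) :
    comm (B.x s u) (B.x r t) = B.commProduct c r s l t u ↔
      exp (B.adString F r s 0 1 u) * exp (B.adString F r s 1 0 t) =
        exp (B.adString F r s 1 0 t) * exp (B.adString F r s 0 1 u) *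
          (l.map fun q => exp (B.adString F r s q.1 q.2
            (B.C q.1 q.2 r s * (-t) ^ q.1 * u ^ q.2))).prod := by
  have factors : ((commFactors c r s l t u).map fun p => B.expEnd F p.1 p.2) =
      l.map fun q => exp (B.adString F r s q.1 q.2 (B.C q.1 q.2 r s * (-t) ^ q.1 * u ^ q.2)) := by
    rw [commFactors, List.map_map]
    exact List.map_congr_left fun q hq =>
      B.expEnd_eq_exp_adString_C hc (hl q hq).1 (hl q hq).2 _ _
  rw [comm_eq_commProduct_iff, ← expEnd_eq_exp_adString, ← expEnd_eq_exp_adString, ← factors]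
  simp only [expEndProd, List.map_cons, List.map_nil, List.prod_cons, List.prod_nil, mul_one,
    mul_assoc, zero_smul, one_smul, zero_add, add_zero]

lemma lie_adString_one_zero_zero_one (h : LinearIndependent ℂ ![r, s]) (t u : F) :
    ⁅B.adString F r s 1 0 t, B.adString F r s 0 1 u⁆ =
      B.adString F r s 1 1 (-(B.C 1 1 r s * (-t) ^ 1 * u ^ 1)) := by
  rw [← one_smul ℚ (B.adString F r s 1 1 _)]
  refine B.lie_adString_eq_smul h rfl rfl one_ne_zero ?_
  simp only [one_smul, zero_smul, add_zero, zero_add, C_one_one]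
  push_cast
  ring

lemma lie_adString_one_zero_one_one (h : LinearIndependent ℂ ![r, s]) (t u : F) :
    ⁅B.adString F r s 1 0 t, B.adString F r s 1 1 (-(B.C 1 1 r s * (-t) ^ 1 * u ^ 1))⁆ =
      (2 : ℚ) • B.adString F r s 2 1 (B.C 2 1 r s * (-t) ^ 2 * u ^ 1) := by
  refine B.lie_adString_eq_smul h rfl rfl two_ne_zero ?_
  simp only [one_smul, zero_smul, add_zero, C_one_one, C_two_one]
  push_cast
  ring

lemma lie_adString_zero_one_one_two (h : LinearIndependent ℂ ![r, s]) (t u : F) :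
    ⁅B.adString F r s 0 1 u, B.adString F r s 1 2 (-(B.C 1 2 r s * (-t) ^ 1 * u ^ 2))⁆ =
      (3 : ℚ) • B.adString F r s 1 3 (B.C 1 3 r s * (-t) ^ 1 * u ^ 3) := by
  refine B.lie_adString_eq_smul h rfl rfl one_ne_zero ?_
  simp only [one_smul, zero_smul, zero_add, C_one_two, C_one_three]
  push_cast
  ring

lemma lie_adString_one_one_one_two (h : LinearIndependent ℂ ![r, s]) (hN : B.N r s ^ 2 = 1)
    (t u : F) :
    ⁅B.adString F r s 1 1 (B.C 1 1 r s * (-t) ^ 1 * u ^ 1),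
      B.adString F r s 1 2 (-(B.C 1 2 r s * (-t) ^ 1 * u ^ 2))⁆ =
        (3 : ℚ) • (1 / 2 : ℚ) • B.adString F r s 2 3 (B.C 2 3 r s * (-t) ^ 2 * u ^ 3) := by
  have hN' : (B.N r s : F) ^ 2 = 1 := by exact_mod_cast hN
  rw [smul_smul]
  refine B.lie_adString_eq_smul h rfl rfl two_ne_zero ?_
  simp only [one_smul, C_one_one, C_one_two, C_two_three]
  push_cast
  linear_combination
    (B.N s (r + s) : F) * B.N (r + s) (r + 2 • s) * t ^ 2 * u ^ 3 / 2 * hN'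

lemma comm_eq_commProduct_short (h : LinearIndependent ℂ ![r, s])
    (hl : CombinationsIn r s [(1, 1), (2, 1), (1, 2)]) (hc : B.HasConstants c r s) (t u : F) :
    comm (B.x s u) (B.x r t) = B.commProduct c r s [(1, 1), (2, 1), (1, 2)] t u := by
  have nilp := B.isNilpotent_adString F r s
  have commute {i j k m : ℕ} (a b : F) (hik : 0 < i + k := by decide)
      (hjm : 0 < j + m := by decide)
      (hn : (i + k, j + m) ∉ [(1, 1), (2, 1), (1, 2)] := by decide) :=
    B.commute_adString h hl (i := i) (j := j) (k := k) (m := m) a b hik hjm hn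
  have yf₁ : ⁅B.adString F r s 0 1 u, B.adString F r s 1 1 (-(B.C 1 1 r s * (-t) ^ 1 * u ^ 1))⁆ =
      (2 : ℚ) • B.adString F r s 1 2 (B.C 1 2 r s * (-t) ^ 1 * u ^ 2) := by
    refine B.lie_adString_eq_smul h rfl rfl one_ne_zero ?_
    simp only [one_smul, zero_smul, zero_add, C_one_one, C_one_two]
    push_cast
    ring
  rw [B.comm_eq_commProduct_iff_exp hc (by decide),
    exp_mul_exp_of_short (nilp ..) (nilp ..) (nilp ..) (nilp ..) (nilp ..)
      (B.lie_adString_one_zero_zero_one h t u) (B.lie_adString_one_zero_one_one h t u)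
      (commute _ _).lie_eq yf₁ (commute _ _) (commute _ _) (commute _ _) (commute _ _)
      (commute _ _)]
  simp only [List.map_cons, List.map_nil, List.prod_cons, List.prod_nil, neg_adString, neg_neg,
    mul_one, ← mul_assoc]

lemma comm_eq_commProduct_long (h : LinearIndependent ℂ ![r, s])
    (hl : CombinationsIn r s [(1, 1), (2, 1), (3, 1), (3, 2)]) (hN : B.N r s ^ 2 = 1)
    (hc : B.HasConstants c r s) (t u : F) :
    comm (B.x s u) (B.x r t) = B.commProduct c r s [(1, 1), (2, 1), (3, 1), (3, 2)] t u := by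
  have nilp := B.isNilpotent_adString F r s
  have commute {i j k m : ℕ} (a b : F) (hik : 0 < i + k := by decide)
      (hjm : 0 < j + m := by decide)
      (hn : (i + k, j + m) ∉ [(1, 1), (2, 1), (3, 1), (3, 2)] := by decide) :=
    B.commute_adString h hl (i := i) (j := j) (k := k) (m := m) a b hik hjm hn
  have xf₂ : ⁅B.adString F r s 1 0 t, B.adString F r s 2 1 (B.C 2 1 r s * (-t) ^ 2 * u ^ 1)⁆ =
      (3 : ℚ) • B.adString F r s 3 1 (-(B.C 3 1 r s * (-t) ^ 3 * u ^ 1)) := by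
    refine B.lie_adString_eq_smul h rfl rfl three_ne_zero ?_
    simp only [one_smul, zero_smul, add_zero, C_two_one, C_three_one]
    push_cast
    ring
  have ff : ⁅B.adString F r s 1 1 (-(B.C 1 1 r s * (-t) ^ 1 * u ^ 1)),
      B.adString F r s 2 1 (B.C 2 1 r s * (-t) ^ 2 * u ^ 1)⁆ =
        (3 : ℚ) • B.adString F r s 3 2 (B.C 3 2 r s * (-t) ^ 3 * u ^ 2) := by
    refine B.lie_adString_eq_smul h rfl rfl three_ne_zero ?_
    have hN' : (B.N r s : F) ^ 2 = 1 := by exact_mod_cast hN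
    simp only [one_smul, C_one_one, C_two_one, C_three_two]
    push_cast
    linear_combination
      (B.N r (r + s) : F) * B.N (r + s) (2 • r + s) * t ^ 3 * u ^ 2 / 2 * hN'
  rw [B.comm_eq_commProduct_iff_exp hc (by decide),
    exp_mul_exp_of_long (nilp ..) (nilp ..) (nilp ..) (nilp ..) (nilp ..) (nilp ..)
      (B.lie_adString_one_zero_zero_one h t u) (B.lie_adString_one_zero_one_one h t u) xf₂
      (commute _ _).lie_eq ff (commute _ _).lie_eq (commute _ _).lie_eq (commute _ _)
      (commute _ _) (commute _ _) (commute _ _) (commute _ _) (commute _ _)]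
  simp only [List.map_cons, List.map_nil, List.prod_cons, List.prod_nil, neg_adString, neg_neg,
    mul_one, ← mul_assoc]

lemma comm_eq_commProduct_long_swap (h : LinearIndependent ℂ ![r, s])
    (hl : CombinationsIn r s [(1, 1), (1, 2), (1, 3), (2, 3)]) (hN : B.N r s ^ 2 = 1)
    (hc : B.HasConstants c r s) (t u : F) :
    comm (B.x s u) (B.x r t) = B.commProduct c r s [(1, 1), (1, 2), (1, 3), (2, 3)] t u := by
  have nilp := B.isNilpotent_adString F r s
  have commute {i j k m : ℕ} (a b : F) (hik : 0 < i + k := by decide) (hjm : 0 < j + m := by decide)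
      (hn : (i + k, j + m) ∉ [(1, 1), (1, 2), (1, 3), (2, 3)] := by decide) :=
    B.commute_adString h hl (i := i) (j := j) (k := k) (m := m) a b hik hjm hn
  have xy : ⁅B.adString F r s 0 1 u, B.adString F r s 1 0 t⁆ =
      (1 : ℚ) • B.adString F r s 1 1 (B.C 1 1 r s * (-t) ^ 1 * u ^ 1) := by
    refine B.lie_adString_eq_smul h rfl rfl one_ne_zero ?_
    simp only [one_smul, zero_smul, add_zero, zero_add, C_one_one, B.N_swap r s]
    push_cast
    ring
  have xf₁ : ⁅B.adString F r s 0 1 u, B.adString F r s 1 1 (B.C 1 1 r s * (-t) ^ 1 * u ^ 1)⁆ =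
      (2 : ℚ) • B.adString F r s 1 2 (-(B.C 1 2 r s * (-t) ^ 1 * u ^ 2)) := by
    refine B.lie_adString_eq_smul h rfl rfl one_ne_zero ?_
    simp only [one_smul, zero_smul, zero_add, C_one_one, C_one_two]
    push_cast
    ring
  have ff := B.lie_adString_one_one_one_two h hN t u
  rw [one_smul] at xy
  have hxy := exp_mul_exp_of_long_swap (nilp ..) (nilp ..) (nilp ..) ((nilp ..).smul _) ff
    (commute _ _) (commute _ _) ((commute _ _).smul_right _) ((commute _ _).smul_right _)
    ((commute _ _).smul_right _)
    (exp_mul_exp_of_long (nilp ..) (nilp ..) (nilp ..) (nilp ..) (nilp ..) ((nilp ..).smul _)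
      xy xf₁ (B.lie_adString_zero_one_one_two h t u) (commute _ _).lie_eq ff
      (commute _ _).lie_eq (commute _ _).lie_eq
      ((commute _ _).smul_right _) (commute _ _) (commute _ _) ((commute _ _).smul_right _)
      ((commute _ _).smul_right _) ((commute _ _).smul_right _))
  rw [B.comm_eq_commProduct_iff_exp hc (by decide), hxy, smul_smul]
  norm_num [neg_adString, mul_assoc]

end Field

/-! ### The commutator formula over a ring -/

lemma prod_N_eq_zero_or (i j : H.root) (n : ℕ) :
    ∏ k ∈ Finset.range n,
        B.N ((rootSystem H).root i) (k • (rootSystem H).root i + (rootSystem H).root j) = 0 ∨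
      ∃ k : H.root, (rootSystem H).root k = n • (rootSystem H).root i + (rootSystem H).root j ∧
        (rootSystem H).chainBotCoeff i k = (rootSystem H).chainBotCoeff i j + n ∧
        |∏ k ∈ Finset.range n,
          B.N ((rootSystem H).root i) (k • (rootSystem H).root i + (rootSystem H).root j)| =
            ((rootSystem H).chainBotCoeff i j + 1).ascFactorial n := by
  induction n with
  | zero => exact .inr ⟨j, by simp only [zero_smul, zero_add], rfl, by simp⟩
  | succ n ih =>
    rw [Finset.prod_range_succ]
    obtain h₀ | ⟨k, hk, hbot, habs⟩ := ih
    · exact .inl (by rw [h₀, zero_mul])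
    rw [← hk]
    by_cases hadd : (rootSystem H).root i + (rootSystem H).root k ∈ roots H
    · obtain ⟨m, hm⟩ := id hadd
      have hik : LinearIndependent ℂ ![(rootSystem H).root i, (rootSystem H).root k] :=
        (rootSystem H).linearIndependent_of_add_mem_range_root' hadd
      refine .inr ⟨m, by rw [hm, hk]; module, ?_, ?_⟩
      · rw [RootPairing.chainBotCoeff_of_add hik (by rw [hm, add_comm]), hbot, add_assoc]
      · rw [abs_mul, habs, B.abs_N i k hadd, hbot, Nat.ascFactorial_succ]
        push_cast
        ring
    · exact .inl (by rw [B.N_eq_zero _ _ fun h => hadd h.2.2, mul_zero])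

lemma factorial_dvd_prod_N (r s : Dual ℂ H) (n : ℕ) :
    (n.factorial : ℤ) ∣ ∏ k ∈ Finset.range n, B.N r (k • r + s) := by
  by_cases h : r ∈ roots H ∧ s ∈ roots H ∧ r + s ∈ roots H
  · obtain ⟨⟨i, rfl⟩, ⟨j, rfl⟩, -⟩ := h
    obtain h₀ | ⟨-, -, -, habs⟩ := B.prod_N_eq_zero_or i j n
    · exact h₀ ▸ dvd_zero _
    · rw [← dvd_abs, habs]
      exact_mod_cast Nat.factorial_dvd_ascFactorial _ _
  · cases n with
    | zero => exact one_dvd _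
    | succ n => simp [Finset.prod_range_succ', B.N_eq_zero r s h]

/-- If `s - r` is a root, then the `r`-string through `s` has at most two members after `s`. -/
lemma six_dvd_N_mul_N {r s : Dual ℂ H} (h : s - r ∈ roots H) : 6 ∣ B.N r s * B.N r (r + s) := by
  by_cases hrs : r ∈ roots H ∧ s ∈ roots H ∧ r + s ∈ roots H
  swap; · rw [B.N_eq_zero r s hrs, zero_mul]; exact dvd_zero 6
  obtain ⟨⟨i, rfl⟩, ⟨j, rfl⟩, -⟩ := hrs
  have one_le : 1 ≤ (rootSystem H).chainBotCoeff i j :=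
    RootPairing.one_le_chainBotCoeff_of_root_add_mem (by
      rw [← (rootSystem H).neg_mem_range_root_iff, neg_sub]; exact h)
  obtain h₀ | ⟨k, -, hbot, habs⟩ := B.prod_N_eq_zero_or i j 2
  all_goals
    simp only [Finset.prod_range_succ, Finset.prod_range_zero, zero_smul, zero_add, one_smul,
      one_mul] at *
  · exact h₀ ▸ dvd_zero 6
  · have le_three := (rootSystem H).chainBotCoeff_add_chainTopCoeff_le_three (i := i) (j := k)
    have eq_one : (rootSystem H).chainBotCoeff i j = 1 := by lia
    rw [← dvd_abs, habs, eq_one]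
    decide

lemma exists_int_M (r s : Dual ℂ H) (n : ℕ) : ∃ m : ℤ, (m : ℚ) = B.M r s n := by
  obtain ⟨m, hm⟩ := B.factorial_dvd_prod_N r s n
  refine ⟨m, ?_⟩
  rw [M, ← Int.cast_prod, hm, Int.cast_mul, Int.cast_natCast, mul_div_cancel_left₀]
  positivity

lemma exists_int_C {r s : Dual ℂ H} (hr : r ∈ roots H) (hs : s ∈ roots H) :
    ∀ p ∈ orderedPairs, ∃ n : ℤ, (n : ℚ) = B.C p.1 p.2 r s := by
  have exists_int_three_two : ∃ m : ℤ, (m : ℚ) = B.C 3 2 r s := by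
    obtain ⟨m, hm⟩ := B.six_dvd_N_mul_N (r := r + s) (s := r)
      (by rw [sub_add_cancel_left]; exact neg_mem_roots_iff.2 hs)
    rw [show r + s + r = 2 • r + s by module] at hm
    refine ⟨m, ?_⟩
    rw [C_three_two, B.N_swap (r + s) r, ← Int.cast_mul, neg_mul, hm]
    push_cast
    ring
  have exists_int_two_three : ∃ m : ℤ, (m : ℚ) = B.C 2 3 r s := by
    obtain ⟨m, hm⟩ := B.six_dvd_N_mul_N (r := r + s) (s := s)
      (by rw [sub_add_cancel_right]; exact neg_mem_roots_iff.2 hr)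
    rw [show r + s + s = r + 2 • s by module] at hm
    refine ⟨-(2 * m), ?_⟩
    rw [C_two_three, B.N_swap (r + s) s, ← Int.cast_mul, neg_mul, hm]
    push_cast
    ring
  have exists_int_neg_one_pow_mul {q : ℚ} (n : ℕ) (h : ∃ m : ℤ, (m : ℚ) = q) :
      ∃ m : ℤ, (m : ℚ) = (-1) ^ n * q := by
    obtain ⟨m, rfl⟩ := h
    exact ⟨(-1) ^ n * m, by push_cast; rfl⟩
  simpa only [orderedPairs, List.forall_mem_cons, List.not_mem_nil, IsEmpty.forall_iff,
    implies_true, and_true] using ⟨B.exists_int_M r s 1, B.exists_int_M r s 2,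
      exists_int_neg_one_pow_mul 2 (B.exists_int_M s r 2), B.exists_int_M r s 3,
      exists_int_neg_one_pow_mul 3 (B.exists_int_M s r 3), exists_int_three_two,
      exists_int_two_three⟩

lemma hasConstants_num {r s : Dual ℂ H} (hr : r ∈ roots H) (hs : s ∈ roots H)
    (h : CombinationsIn r s orderedPairs) :
    B.HasConstants (fun i j => (B.C i j r s).num) r s := by
  intro i j hi hj hij
  obtain ⟨n, hn⟩ := B.exists_int_C hr hs (i, j) (h i j hi hj hij)
  exact (congrArg (fun q : ℚ => (q.num : ℚ)) hn).symm.trans hn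

lemma abs_N_of_chain {r s : Dual ℂ H} (hr : r ∈ roots H) (hs : s ∈ roots H) (hrs : r + s ∈ roots H)
    {n : ℕ} (hn : s - n • r ∈ roots H) (hn' : s - (n + 1) • r ∉ roots H) :
    |B.N r s| = n + 1 := by
  have h := linearIndependent_of_add_mem_roots hr hs hrs
  obtain ⟨i, rfl⟩ := hr
  obtain ⟨j, rfl⟩ := hs
  have le_bot := ((rootSystem H).root_sub_nsmul_mem_range_iff_le_chainBotCoeff h).1 hn
  have bot_lt := mt ((rootSystem H).root_sub_nsmul_mem_range_iff_le_chainBotCoeff h).2 hn'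
  rw [B.abs_N i j hrs]
  lia

lemma sq_N_eq_one {r s : Dual ℂ H} (hr : r ∈ roots H) (hs : s ∈ roots H) (hrs : r + s ∈ roots H)
    (hsr : s - r ∉ roots H) : B.N r s ^ 2 = 1 := by
  have abs_eq : |B.N r s| = (0 : ℕ) + 1 :=
    B.abs_N_of_chain hr hs hrs (by simpa using hs) (by simpa using hsr)
  rw [← sq_abs, abs_eq, Nat.cast_zero, zero_add, one_pow]

lemma x_eq_one_of_notMem {r : Dual ℂ H} {K : Type*} [CommRing K] (hr : r ∉ roots H) (t : K) :
    B.x r t = 1 := by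
  ext1
  ext1
  change B.expEnd K r t = 1
  rw [← B.expEnd_zero K r, expEnd, expEnd]
  refine Finset.sum_congr rfl fun n _ => ?_
  cases n with
  | zero => simp only [pow_zero]
  | succ n =>
    have latticeDiv_eq_zero : B.latticeDiv r (n + 1) = 0 := by
      ext v
      simp [latticeDiv, adDiv, B.e_eq_zero r hr]
    simp [latticeDiv_eq_zero]

lemma rootProduct_eq_commProduct {K : Type*} [CommRing K] {r s : Dual ℂ H}
    {l : List (ℕ × ℕ)} (hl : CombinationsIn r s l) (hl' : orderedPairs.filter (· ∈ l) = l)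
    (c : ℕ → ℕ → ℤ) (t u : K) :
    rootProduct B c r s t u = B.commProduct c r s l t u := by
  have pos : ∀ p ∈ orderedPairs, 0 < p.1 ∧ 0 < p.2 := by decide
  classical
  rw [rootProduct, prod_map_filter _ _ _ fun p _ hp => B.x_eq_one_of_notMem hp _, commProduct,
    commFactors, List.map_map, ← hl', prod_map_filter]
  · rfl
  · exact fun p hp hpl => B.x_eq_one_of_notMem
      (fun h => hpl (hl _ _ (pos p hp).1 (pos p hp).2 h)) _

end ChevalleyBasis

/-! ### Coordinates with respect to a fundamental pair -/

/-- The coordinates of the roots of type `G₂` with respect to the fundamental roots. -/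
def rootCoords : Finset (ℤ × ℤ) :=
  {(1, 0), (0, 1), (1, 1), (2, 1), (3, 1), (3, 2),
    (-1, 0), (0, -1), (-1, -1), (-2, -1), (-3, -1), (-3, -2)}

/-- The vector with given coordinates with respect to `a` and `b`. -/
def ofCoords {V : Type*} [AddCommGroup V] (a b : V) : ℤ × ℤ →+ V where
  toFun p := p.1 • a + p.2 • b
  map_zero' := by simp
  map_add' p q := by simp only [Prod.fst_add, Prod.snd_add, add_smul]; abel

lemma ofCoords_apply {V : Type*} [AddCommGroup V] (a b : V) (p : ℤ × ℤ) :
    ofCoords a b p = p.1 • a + p.2 • b := rfl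

variable {a b : Dual ℂ H}

/-- The root system with the embedded `G₂` spanned by a fundamental pair. -/
@[reducible]
noncomputable def embeddedG2 {i j : H.root} (h : (rootSystem H).pairing j i = -3) :
    (rootSystem H).EmbeddedG2 where
  long := j
  short := i
  pairingIn_long_short := by
    have := (rootSystem H).algebraMap_pairingIn ℤ j i
    rw [h, algebraMap_int_eq, eq_intCast] at this
    exact_mod_cast this

lemma ofCoords_injective (hab : IsFundamentalPair H a b) :
    Function.Injective (ofCoords a b) := by
  obtain ⟨i, j, rfl, rfl, h⟩ := hab
  let _ := embeddedG2 h
  have indep := RootPairing.EmbeddedG2.linearIndependent_short_long (rootSystem H)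
  rw [injective_iff_map_eq_zero]
  rintro ⟨m, n⟩ h₀
  rw [ofCoords_apply, ← Int.cast_smul_eq_zsmul ℂ, ← Int.cast_smul_eq_zsmul ℂ] at h₀
  obtain ⟨hm, hn⟩ := LinearIndependent.pair_iff.1 indep (m : ℂ) (n : ℂ) h₀
  exact Prod.ext (Int.cast_eq_zero.1 hm) (Int.cast_eq_zero.1 hn)

lemma mem_roots_iff_mem_allRoots {i j : H.root} (h : (rootSystem H).pairing j i = -3)
    {r : Dual ℂ H} :
    letI := embeddedG2 h
    r ∈ roots H ↔ r ∈ RootPairing.EmbeddedG2.allRoots (rootSystem H) := by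
  let _ := embeddedG2 h
  constructor
  · rintro ⟨k, rfl⟩
    exact RootPairing.EmbeddedG2.mem_allRoots _ k
  · intro hr
    classical
    exact RootPairing.EmbeddedG2.allRoots_subset_range_root (rootSystem H)
      (List.mem_toFinset.2 hr)

lemma mem_roots_iff (hab : IsFundamentalPair H a b) {r : Dual ℂ H} :
    r ∈ roots H ↔ ∃ p ∈ rootCoords, ofCoords a b p = r := by
  obtain ⟨i, j, rfl, rfl, h⟩ := hab
  let _ := embeddedG2 h
  have combination_eq (c : Fin 2 → ℤ) : Fintype.linearCombination ℤ
      ![(rootSystem H).root i, (rootSystem H).root j] c =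
        ofCoords ((rootSystem H).root i) ((rootSystem H).root j) (c 0, c 1) := by
    simp only [ofCoords_apply, Fintype.linearCombination_apply, Fin.sum_univ_two,
      Matrix.cons_val_zero, Matrix.cons_val_one]
  rw [mem_roots_iff_mem_allRoots h, RootPairing.EmbeddedG2.allRoots_eq_map_allCoeffs, List.mem_map]
  constructor
  · rintro ⟨c, hc, rfl⟩
    have mem_rootCoords : ∀ c ∈ RootPairing.EmbeddedG2.allCoeffs, (c 0, c 1) ∈ rootCoords := by
      decide
    exact ⟨_, mem_rootCoords c hc, (combination_eq c).symm⟩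
  · rintro ⟨p, hp, rfl⟩
    have mem_allCoeffs : ∀ p ∈ rootCoords, ![p.1, p.2] ∈ RootPairing.EmbeddedG2.allCoeffs := by
      decide
    exact ⟨_, mem_allCoeffs p hp, combination_eq _⟩

lemma ofCoords_mem_roots_iff (hab : IsFundamentalPair H a b) {p : ℤ × ℤ} :
    ofCoords a b p ∈ roots H ↔ p ∈ rootCoords := by
  rw [mem_roots_iff hab]
  constructor
  · rintro ⟨q, hq, h⟩
    rwa [← ofCoords_injective hab h]
  · exact fun h => ⟨p, h, rfl⟩

lemma lt_four_of_mem_rootCoords {p q : ℤ × ℤ} (hp : p ∈ rootCoords) (hq : q ∈ rootCoords)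
    (hpq : p + q ∈ rootCoords) {i j : ℕ} (h : i • p + j • q ∈ rootCoords) : i < 4 ∧ j < 4 := by
  have det_ne_zero : ∀ p ∈ rootCoords, ∀ q ∈ rootCoords, p + q ∈ rootCoords →
      p.1 * q.2 - p.2 * q.1 ≠ 0 := by decide +kernel
  have abs_det_le : ∀ p ∈ rootCoords, ∀ q ∈ rootCoords, |p.1 * q.2 - p.2 * q.1| ≤ 3 := by
    decide +kernel
  have one_le := Int.one_le_abs (det_ne_zero p hp q hq hpq)
  have det_left : (i • p + j • q).1 * q.2 - (i • p + j • q).2 * q.1 =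
      i * (p.1 * q.2 - p.2 * q.1) := by
    simp only [Prod.fst_add, Prod.snd_add, Prod.smul_fst, Prod.smul_snd, smul_eq_mul,
      ← Nat.cast_smul_eq_nsmul ℤ]
    ring
  have det_right : p.1 * (i • p + j • q).2 - p.2 * (i • p + j • q).1 =
      j * (p.1 * q.2 - p.2 * q.1) := by
    simp only [Prod.fst_add, Prod.snd_add, Prod.smul_fst, Prod.smul_snd, smul_eq_mul,
      ← Nat.cast_smul_eq_nsmul ℤ]
    ring
  have hi := abs_det_le _ h q hq
  have hj := abs_det_le p hp _ h
  rw [det_left, abs_mul, Nat.abs_cast] at hi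
  rw [det_right, abs_mul, Nat.abs_cast] at hj
  constructor <;> zify <;> nlinarith

lemma combinationsIn_cases (hab : IsFundamentalPair H a b) {r s : Dual ℂ H} (hr : r ∈ roots H)
    (hs : s ∈ roots H) (hrs : r + s ∈ roots H) :
    CombinationsIn r s [(1, 1), (2, 1), (1, 2)] ∨
      CombinationsIn r s [(1, 1), (2, 1), (3, 1), (3, 2)] ∧ s - r ∉ roots H ∨
      CombinationsIn r s [(1, 1), (1, 2), (1, 3), (2, 3)] ∧ s - r ∉ roots H := by
  obtain ⟨p, hp, rfl⟩ := (mem_roots_iff hab).1 hr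
  obtain ⟨q, hq, rfl⟩ := (mem_roots_iff hab).1 hs
  rw [← map_add, ofCoords_mem_roots_iff hab] at hrs
  have combinationsIn_of_forall {l : List (ℕ × ℕ)}
      (h : ∀ k ∈ Finset.Ioo 0 4 ×ˢ Finset.Ioo 0 4, k.1 • p + k.2 • q ∈ rootCoords → k ∈ l) :
      CombinationsIn (ofCoords a b p) (ofCoords a b q) l := by
    intro i j hi hj hij
    rw [← map_nsmul, ← map_nsmul, ← map_add, ofCoords_mem_roots_iff hab] at hij
    obtain ⟨hi', hj'⟩ := lt_four_of_mem_rootCoords hp hq hrs hij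
    exact h (i, j)
      (Finset.mem_product.2 ⟨Finset.mem_Ioo.2 ⟨hi, hi'⟩, Finset.mem_Ioo.2 ⟨hj, hj'⟩⟩) hij
  have cases : ∀ p ∈ rootCoords, ∀ q ∈ rootCoords, p + q ∈ rootCoords →
      (∀ k ∈ Finset.Ioo 0 4 ×ˢ Finset.Ioo 0 4, k.1 • p + k.2 • q ∈ rootCoords →
        k ∈ [(1, 1), (2, 1), (1, 2)]) ∨
      (∀ k ∈ Finset.Ioo 0 4 ×ˢ Finset.Ioo 0 4, k.1 • p + k.2 • q ∈ rootCoords →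
        k ∈ [(1, 1), (2, 1), (3, 1), (3, 2)]) ∧ q - p ∉ rootCoords ∨
      (∀ k ∈ Finset.Ioo 0 4 ×ˢ Finset.Ioo 0 4, k.1 • p + k.2 • q ∈ rootCoords →
        k ∈ [(1, 1), (1, 2), (1, 3), (2, 3)]) ∧ q - p ∉ rootCoords := by
    decide +kernel
  rw [← map_sub, ofCoords_mem_roots_iff hab]
  exact (cases p hp q hq hrs).imp combinationsIn_of_forall
    (.imp (.imp_left combinationsIn_of_forall) (.imp_left combinationsIn_of_forall))

lemma combinationsIn_orderedPairs (hab : IsFundamentalPair H a b) {r s : Dual ℂ H}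
    (hr : r ∈ roots H) (hs : s ∈ roots H) (hrs : r + s ∈ roots H) :
    CombinationsIn r s orderedPairs := by
  have mono {l : List (ℕ × ℕ)} (h : CombinationsIn r s l) (hl : l ⊆ orderedPairs) :
      CombinationsIn r s orderedPairs := fun i j hi hj hij => hl (h i j hi hj hij)
  obtain h | ⟨h, -⟩ | ⟨h, -⟩ := combinationsIn_cases hab hr hs hrs
  all_goals exact mono h (by decide)

/-- The roots with coordinates `p` and `q` have a root as their sum, and `n - 1` is the greatest
integer `m` for which `q - m • p` are the coordinates of a root. -/
abbrev ChainLength (p q : ℤ × ℤ) (n : ℤ) : Prop :=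
  p ∈ rootCoords ∧ q ∈ rootCoords ∧ p + q ∈ rootCoords ∧ 0 < n ∧ q - (n - 1) • p ∈ rootCoords ∧
    q - n • p ∉ rootCoords

namespace ChevalleyBasis

variable (B : ChevalleyBasis H)

lemma comm_eq_rootProduct (hab : IsFundamentalPair H a b)
    {r s : Dual ℂ H} (hr : r ∈ roots H) (hs : s ∈ roots H) (hrs : r + s ∈ roots H)
    {c : ℕ → ℕ → ℤ} (hc : B.HasConstants c r s) {K : Type*} [CommRing K] (t u : K) :
    comm (B.x s u) (B.x r t) = rootProduct B c r s t u := by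
  have indep := linearIndependent_of_add_mem_roots hr hs hrs
  obtain h | ⟨h, hsr⟩ | ⟨h, hsr⟩ := combinationsIn_cases hab hr hs hrs
  · rw [B.rootProduct_eq_commProduct h (by decide)]
    exact B.comm_eq_commProduct_of_forall_field
      (fun _ _ _ t u => B.comm_eq_commProduct_short indep h hc t u) t u
  · rw [B.rootProduct_eq_commProduct h (by decide)]
    exact B.comm_eq_commProduct_of_forall_field (fun _ _ _ t u =>
      B.comm_eq_commProduct_long indep h (B.sq_N_eq_one hr hs hrs hsr) hc t u) t u
  · rw [B.rootProduct_eq_commProduct h (by decide)]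
    exact B.comm_eq_commProduct_of_forall_field (fun _ _ _ t u =>
      B.comm_eq_commProduct_long_swap indep h (B.sq_N_eq_one hr hs hrs hsr) hc t u) t u

/-! ### The tables -/

lemma N_eq_mul_of_add_eq_zero {r s w : Dual ℂ H} (h : r + s + w = 0) {m n k : ℤ} (hm : m ≠ 0)
    (hrs : |B.N r s| = m) (hsw : |B.N s w| = n) (hk : B.N r s = m * k) : B.N s w = n * k := by
  have cyclic := B.N_mul_abs_N_cyclic h
  rw [hrs, hsw, hk] at cyclic
  exact mul_right_cancel₀ hm (by linear_combination -cyclic)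

lemma N_symmetries_of_eq {r s : Dual ℂ H} {k : ℤ} (h : B.N r s = k) :
    B.N r s = k ∧ B.N s r = -k ∧ B.N (-r) (-s) = -k ∧ B.N (-s) (-r) = k := by
  rw [B.N_neg, B.N_neg, B.N_swap r s, h, neg_neg]
  exact ⟨rfl, rfl, rfl, rfl⟩

/-- The structure constant `N_{r,s}` of the linear forms `r` and `s` with coordinates `p` and `q`
with respect to `a` and `b`. -/
def nCoord (a b : Dual ℂ H) (p q : ℤ × ℤ) : ℤ :=
  B.N (ofCoords a b p) (ofCoords a b q)

lemma N_ofCoords (p q : ℤ × ℤ) :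
    B.N (ofCoords a b p) (ofCoords a b q) = B.nCoord a b p q := rfl

lemma abs_nCoord (hab : IsFundamentalPair H a b) {p q : ℤ × ℤ} {n : ℤ}
    (h : ChainLength p q n) : |B.nCoord a b p q| = n := by
  obtain ⟨hp, hq, hpq, hn, hmem, hnotMem⟩ := h
  lift n - 1 to ℕ using by omega with m hm
  obtain rfl : n = m + 1 := by omega
  rw [natCast_zsmul, ← ofCoords_mem_roots_iff hab, map_sub, map_nsmul] at hmem
  rw [← Nat.cast_succ, natCast_zsmul, ← ofCoords_mem_roots_iff hab, map_sub, map_nsmul] at hnotMem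
  rw [← ofCoords_mem_roots_iff hab] at hp hq hpq
  rw [map_add] at hpq
  exact B.abs_N_of_chain hp hq hpq hmem hnotMem

lemma nCoord_symmetries_of_eq {p q : ℤ × ℤ} {k : ℤ} (h : B.nCoord a b p q = k) :
    B.nCoord a b p q = k ∧ B.nCoord a b q p = -k ∧ B.nCoord a b (-p) (-q) = -k ∧
      B.nCoord a b (-q) (-p) = k := by
  simpa only [nCoord, map_neg] using B.N_symmetries_of_eq h

lemma nCoord_cyclic (hab : IsFundamentalPair H a b) {p q w : ℤ × ℤ} {m n k : ℤ}
    (h : p + q + w = 0) (hpq : ChainLength p q m) (hqw : ChainLength q w n)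
    (hk : B.nCoord a b p q = m * k) : B.nCoord a b q w = n * k := by
  refine B.N_eq_mul_of_add_eq_zero ?_ hpq.2.2.2.1.ne' (B.abs_nCoord hab hpq)
    (B.abs_nCoord hab hqw) hk
  rw [← map_add, ← map_add, h, map_zero]

lemma nCoord_of_triple (hab : IsFundamentalPair H a b) (p q w : ℤ × ℤ) {k : ℤ} (m n l : ℤ)
    (h : p + q + w = 0 ∧ ChainLength p q m ∧ ChainLength q w n ∧ ChainLength w p l)
    (hk : B.nCoord a b p q = m * k) :
    (B.nCoord a b p q = m * k ∧ B.nCoord a b q p = -(m * k) ∧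
      B.nCoord a b (-p) (-q) = -(m * k) ∧ B.nCoord a b (-q) (-p) = m * k) ∧
    (B.nCoord a b q w = n * k ∧ B.nCoord a b w q = -(n * k) ∧
      B.nCoord a b (-q) (-w) = -(n * k) ∧ B.nCoord a b (-w) (-q) = n * k) ∧
    (B.nCoord a b w p = l * k ∧ B.nCoord a b p w = -(l * k) ∧
      B.nCoord a b (-w) (-p) = -(l * k) ∧ B.nCoord a b (-p) (-w) = l * k) := by
  obtain ⟨hsum, hpq, hqw, hwp⟩ := h
  have hqw_eq := B.nCoord_cyclic hab hsum hpq hqw hk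
  have hwp_eq := B.nCoord_cyclic hab (by rw [← hsum, add_rotate]; abel) hqw hwp hqw_eq
  exact ⟨B.nCoord_symmetries_of_eq hk, B.nCoord_symmetries_of_eq hqw_eq,
    B.nCoord_symmetries_of_eq hwp_eq⟩

lemma nCoord_one_one_two_one (hab : IsFundamentalPair H a b) {ε₁ ε₃ ε₄ ε₅ : ℤ}
    (h₁ : B.nCoord a b (1, 0) (0, 1) = ε₁) (h₃ : B.nCoord a b (1, 0) (2, 1) = 3 * ε₃)
    (h₄ : B.nCoord a b (0, 1) (3, 1) = ε₄) (h₅ : (ε₅ : ℚ) = ε₁ * ε₃ / ε₄) :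
    B.nCoord a b (1, 1) (2, 1) = 3 * -ε₅ := by
  have abs_ε₁ : |ε₁| = 1 := h₁ ▸ B.abs_nCoord hab (n := 1) (by decide)
  have abs_ε₄ : |ε₄| = 1 := h₄ ▸ B.abs_nCoord hab (n := 1) (by decide)
  have sq_ε₁ : ε₁ ^ 2 = 1 := by rw [← sq_abs, abs_ε₁, one_pow]
  have sq_ε₄ : (ε₄ : ℚ) ^ 2 = 1 := by rw [← sq_abs, ← Int.cast_abs, abs_ε₄, Int.cast_one, one_pow]
  have ε₅_eq : ε₅ = ε₁ * ε₃ * ε₄ := by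
    have ε₄_ne_zero : (ε₄ : ℚ) ≠ 0 := by intro h; norm_num [h] at sq_ε₄
    rw [eq_div_iff ε₄_ne_zero] at h₅
    exact_mod_cast (by linear_combination ε₄ * h₅ - ε₅ * sq_ε₄ : (ε₅ : ℚ) = ε₁ * ε₃ * ε₄)
  have N_eq_zero : B.nCoord a b (0, 1) (2, 1) = 0 := by
    refine B.N_eq_zero _ _ fun h => ?_
    simp only [← map_add, ofCoords_mem_roots_iff hab] at h
    exact absurd h.2.2 (by decide)
  have jacobi : B.nCoord a b (1, 0) (0, 1) * B.nCoord a b (1, 1) (2, 1) +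
      B.nCoord a b (0, 1) (2, 1) * B.nCoord a b (2, 2) (1, 0) +
      B.nCoord a b (2, 1) (1, 0) * B.nCoord a b (3, 1) (0, 1) = 0 := by
    have ne_zero {p : ℤ × ℤ} (hp : p ≠ 0) : ofCoords a b p ≠ 0 :=
      (map_ne_zero_iff _ (ofCoords_injective hab)).2 hp
    have N_jacobi := B.N_jacobi (r := ofCoords a b (1, 0)) (s := ofCoords a b (0, 1))
      (w := ofCoords a b (2, 1))
    simp only [← map_add, ofCoords_mem_roots_iff hab] at N_jacobi
    exact N_jacobi (ne_zero (by decide)) (ne_zero (by decide)) (ne_zero (by decide)) (by decide)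
  rw [h₁, (B.nCoord_symmetries_of_eq h₃).2.1, (B.nCoord_symmetries_of_eq h₄).2.1,
    N_eq_zero] at jacobi
  linear_combination ε₁ * jacobi - B.nCoord a b (1, 1) (2, 1) * sq_ε₁ + 3 * ε₅_eq

lemma constantTable_coords (hab : IsFundamentalPair H a b) {ε₁ ε₂ ε₃ ε₄ ε₅ : ℤ}
    (h₁ : B.nCoord a b (1, 0) (0, 1) = ε₁) (h₂ : B.nCoord a b (1, 0) (1, 1) = 2 * ε₂)
    (h₃ : B.nCoord a b (1, 0) (2, 1) = 3 * ε₃) (h₄ : B.nCoord a b (0, 1) (3, 1) = ε₄)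
    (h₅ : (ε₅ : ℚ) = ε₁ * ε₃ / ε₄) :
    ConstantTable B.C (ofCoords a b (1, 0)) (ofCoords a b (0, 1)) ε₁ ε₂ ε₃ ε₄ ε₅ := by
  have v₁ := B.nCoord_of_triple hab (1, 0) (0, 1) (-1, -1) 1 1 3 (by decide) (by rw [h₁, one_mul])
  have v₂ := B.nCoord_of_triple hab (1, 0) (1, 1) (-2, -1) 2 2 2 (by decide) h₂
  have v₃ := B.nCoord_of_triple hab (1, 0) (2, 1) (-3, -1) 3 1 1 (by decide) h₃
  have v₄ := B.nCoord_of_triple hab (0, 1) (3, 1) (-3, -2) 1 1 1 (by decide)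
    (by rw [h₄, one_mul])
  have v₅ := B.nCoord_of_triple hab (1, 1) (2, 1) (-3, -2) 3 1 1 (by decide)
    (B.nCoord_one_one_two_one hab h₁ h₃ h₄ h₅)
  simp only [Prod.neg_mk, Int.reduceNeg, neg_zero, neg_neg] at v₁ v₂ v₃ v₄ v₅
  simp only [ConstantTable, ConstantsAre, List.forall_mem_cons, and_true, C_one_one, C_two_one,
    C_three_one, C_one_two, C_one_three, C_three_two, C_two_three, List.not_mem_nil,
    IsEmpty.forall_iff, implies_true, ← map_add, ← map_sub, ← map_neg, ← map_nsmul, N_ofCoords,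
    Prod.mk_add_mk, Prod.smul_mk, Prod.neg_mk, Prod.mk_sub_mk, nsmul_eq_mul, Nat.cast_ofNat,
    Int.reduceAdd, Int.reduceMul, Int.reduceNeg, Int.reduceSub, neg_zero, v₁, v₂, v₃, v₄, v₅]
  repeat' apply And.intro
  all_goals push_cast
  all_goals ring

lemma constantTable (hab : IsFundamentalPair H a b) {ε₁ ε₂ ε₃ ε₄ ε₅ : ℤ}
    (h₁ : B.N a b = ε₁) (h₂ : B.N a (a + b) = 2 * ε₂) (h₃ : B.N a (2 • a + b) = 3 * ε₃)
    (h₄ : B.N b (3 • a + b) = ε₄) (h₅ : (ε₅ : ℚ) = ε₁ * ε₃ / ε₄) :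
    ConstantTable B.C a b ε₁ ε₂ ε₃ ε₄ ε₅ := by
  have table := B.constantTable_coords hab (ε₁ := ε₁) (ε₂ := ε₂) (ε₃ := ε₃) (ε₄ := ε₄) (ε₅ := ε₅)
  simp only [nCoord, ofCoords_apply, one_smul, zero_smul, add_zero, zero_add, ofNat_smul_eq_nsmul]
    at table
  exact table h₁ h₂ h₃ h₄ h₅

variable {K : Type*} [CommRing K]

open Classical in
lemma comm_eq_prod_of_constantsAre (hab : IsFundamentalPair H a b) {p q : ℤ × ℤ}
    {l : List ((ℕ × ℕ) × ℚ)} (hpq : p ∈ rootCoords ∧ q ∈ rootCoords ∧ p + q ∈ rootCoords)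
    (h : ConstantsAre B.C (ofCoords a b p) (ofCoords a b q) l)
    (hl : orderedPairs.filter (fun k => k.1 • p + k.2 • q ∈ rootCoords) = l.map Prod.fst)
    (t u : K) :
    comm (B.x (ofCoords a b q) u) (B.x (ofCoords a b p) t) =
      (l.map fun k => B.x (ofCoords a b (k.1.1 • p + k.1.2 • q))
        ((k.2.num : K) * (-t) ^ k.1.1 * u ^ k.1.2)).prod := by
  simp only [← ofCoords_mem_roots_iff hab, map_add] at hpq
  obtain ⟨hp, hq, hpq⟩ := hpq
  have hc := B.hasConstants_num hp hq (combinationsIn_orderedPairs hab hp hq hpq)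
  rw [B.comm_eq_rootProduct hab hp hq hpq hc, rootProduct]
  have filter_eq : orderedPairs.filter
      (fun k => k.1 • ofCoords a b p + k.2 • ofCoords a b q ∈ roots H) = l.map Prod.fst := by
    simp only [← hl, ← map_nsmul, ← map_add, ofCoords_mem_roots_iff hab]
  simp only [filter_eq, List.map_map]
  refine congrArg _ (List.map_congr_left fun k hk => ?_)
  simp only [Function.comp_apply, h k hk, map_add, map_nsmul]

lemma commutatorFormulas_coords (hab : IsFundamentalPair H a b) {ε₁ ε₂ ε₃ ε₄ ε₅ : ℤ}
    (h : ConstantTable B.C (ofCoords a b (1, 0)) (ofCoords a b (0, 1)) ε₁ ε₂ ε₃ ε₄ ε₅) (t u : K) :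
    CommutatorFormulas B.x (ofCoords a b (1, 0)) (ofCoords a b (0, 1))
      (ε₁ : K) ε₂ ε₃ ε₄ ε₅ t u := by
  simp only [ConstantTable, ← map_add, ← map_sub, ← map_neg, ← map_nsmul] at h
  simp only [CommutatorFormulas, PositiveFormulas, NegativeFormulas, MixedFormulasI,
    MixedFormulasII, MixedFormulasIII, RemainingFormulas,
    ← map_add, ← map_sub, ← map_neg, ← map_nsmul]
  norm_cast at h
  casesm* _ ∧ _
  repeat' apply And.intro
  all_goals
    with_reducible refine (B.comm_eq_prod_of_constantsAre hab (by decide +kernel) ‹_›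
      (by simp only [List.map]; decide +kernel) t u).trans ?_
  all_goals
    simp only [List.map_cons, List.map_nil, List.prod_cons, List.prod_nil, mul_one, ← mul_assoc,
      Rat.num_intCast]
    push_cast
    ring_nf

lemma commutatorFormulas (hab : IsFundamentalPair H a b) {ε₁ ε₂ ε₃ ε₄ ε₅ : ℤ}
    (h : ConstantTable B.C a b ε₁ ε₂ ε₃ ε₄ ε₅) (t u : K) :
    CommutatorFormulas B.x a b (ε₁ : K) ε₂ ε₃ ε₄ ε₅ t u := by
  have formulas := B.commutatorFormulas_coords hab (ε₁ := ε₁) (ε₂ := ε₂) (ε₃ := ε₃) (ε₄ := ε₄)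
    (ε₅ := ε₅) (t := t) (u := u)
  simp only [ofCoords_apply, one_smul, zero_smul, add_zero, zero_add] at formulas
  exact formulas h

end ChevalleyBasis

end G2

open Module in
theorem mainTheorem2 {L : Type*} [LieRing L] [LieAlgebra ℂ L] [FiniteDimensional ℂ L]
    [LieAlgebra.IsSimple ℂ L] (H : LieSubalgebra ℂ L) [H.IsCartanSubalgebra]
    (a b : Dual ℂ H) (hab : G2.IsFundamentalPair H a b) (B : G2.ChevalleyBasis H)
    (ε₁ ε₂ ε₃ ε₄ ε₅ : ℤ) (h₁ : B.N a b = ε₁) (h₂ : B.N a (a + b) = 2 * ε₂)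
    (h₃ : B.N a (2 • a + b) = 3 * ε₃) (h₄ : B.N b (3 • a + b) = ε₄)
    (h₅ : (ε₅ : ℚ) = ε₁ * ε₃ / ε₄) (K : Type*) [CommRing K] :
    (∀ r ∈ G2.roots H, ∀ s ∈ G2.roots H, r + s ∈ G2.roots H →
      (∀ i j : ℕ, 0 < i → 0 < j → i • r + j • s ∈ G2.roots H → (i, j) ∈ G2.orderedPairs) ∧
      ∃ c : ℕ → ℕ → ℤ,
        (∀ i j : ℕ, 0 < i → 0 < j → i • r + j • s ∈ G2.roots H → (c i j : ℚ) = B.C i j r s) ∧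
        ∀ t u : K, G2.comm (B.x s u) (B.x r t) = G2.rootProduct B c r s t u) ∧
    G2.ConstantTable B.C a b ε₁ ε₂ ε₃ ε₄ ε₅ ∧
    ∀ t u : K, G2.CommutatorFormulas B.x a b (ε₁ : K) ε₂ ε₃ ε₄ ε₅ t u := by
  refine ⟨fun r hr s hs hrs => ?_, ?_⟩
  · have combinations := G2.combinationsIn_orderedPairs hab hr hs hrs
    have constants := B.hasConstants_num hr hs combinations
    exact ⟨combinations, fun i j => (B.C i j r s).num, constants,
      B.comm_eq_rootProduct hab hr hs hrs constants⟩
  · have table := B.constantTable hab h₁ h₂ h₃ h₄ h₅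
    exact ⟨table, B.commutatorFormulas hab table⟩
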